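/- Let $p\ge 3$ be a prime. Let $T|S$ be a finite, totally (purely) ramified extension of discrete valuation rings of residue characteristic $p$ whose extension of fraction fields $L|K$ is Galois of degree $p$, with Galois group $G=\mathrm{Aut}_S(T)=\langle\sigma\rangle\cong C_p$. Let $t$ be a uniformizer of $T$ and let $s:=(-1)^{p+1}\mathrm{N}_{L|K}(t)$, a uniformizer of $S$. Put $b:=-1+\mathrm{val}_t(\sigma(t)-t)$ and write $b=p\underline{b}+\overline{b}$ with $0\le\overline{b}\le p-1$, so $\underline{b}=\lfloor b/p\rfloor$. Assume $b\ge 1$ and $\mathrm{val}_s(p)\ge b-\underline{b}$ (where $\mathrm{val}_s(0)=+\infty$). Let $\Xi:=T\wr G$ be the twisted group ring, that is, the free $T$-module on $G$ with multiplication $(y\rho)(z\tau)=y\,\rho(z)\,\rho\tau$, where $\rho\tau$ means "first $\tau$, then $\rho$", acting from the left on $T$ by $(y\rho)\cdot x=y\,\rho(x)$. Ext is taken over left $\Xi$-modules (equivalently, composing maps from left to right: right modules over the ring with $(\rho y)(\tau z)=(\rho\tau)(y^{\tau}z)$). Then there are elements $\alpha,\beta\in\Xi$ which act on the basis $t^0,\dots,t^{p-1}$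 of $T$ over $S$ by $$\alpha\cdot t^l=\begin{cases}s^{\,b-\underline{b}}&\text{if } l=\overline{b}\\ 0&\text{if } l\neq\overline{b}\end{cases}\qquad\text{and}\qquad \beta\cdot t^l=l\,s^{\,\underline{b}+\lfloor (l+\overline{b})/p\rfloor}\,t^{(l+\overline{b})\bmod p}\qquad(0\le l\le p-1),$$ and there is a projective resolution of $T$ over $\Xi$ $$P=\bigl(\cdots\to\Xi\xrightarrow{\ \alpha\ }\Xi\xrightarrow{\ \beta\ }\Xi\xrightarrow{\ \alpha\ }\Xi\xrightarrow{\ \beta\ }\Xi\to 0\bigr)$$ (the right-hand $\Xi$ in degree $0$), in which the maps are the $\Xi$-linear maps $1\mapsto\alpha$ and $1\mapsto\beta$ and the augmentation $\Xi\to T$ is $1\mapsto 1$. For $0\le k\le p-1$ let $\chi_k:\Xi\to T$ be the $\Xi$-linear map with $\chi_k(1)=t^k$. Computing $\mathrm{Ext}^*_{T\wr G}(T,T)$ as the cohomology of $\mathrm{Hom}_\Xi(P,T)$, the $\chi_k$ named below are cocycles in the respective degrees, and there are isomorphisms of $S$-modules as follows. * $\mathrm{Ext}^0_{T\wr G}(T,T)\cong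 S$, with the class of $\chi_0$ corresponding to $1$. * For $i\ge 1$: $\mathrm{Ext}^{2i}_{T\wr G}(T,T)\cong S/s^{\,b-\underline{b}}S$, with the class of $\chi_0$ corresponding to the class of $1$. * For $i\ge 0$: $$\mathrm{Ext}^{2i+1}_{T\wr G}(T,T)\cong\Bigl(\bigoplus_{0\le k<\overline{b}}S/s^{\,\underline{b}+1}S\Bigr)\oplus\Bigl(\bigoplus_{\overline{b}<k\le p-1}S/s^{\,\underline{b}}S\Bigr),$$ with the class of $\chi_k$ ($k\neq\overline{b}$) corresponding to the class of $1$ in the $k$-th summand. -/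

import Mathlib

open CategoryTheory CategoryTheory.Abelian IsDiscreteValuationRing
open scoped ModuleCat.Algebra

universe u v

/-- The twisted group ring of `G = Aut_S(T)` over `T`: the free `T`-module on `G` with
`(y ρ) (z τ) = (y * ρ z) (ρ τ)`, where `y, z ∈ T` and `ρ, τ ∈ G`.  Here `ρ τ` is the composite
"first `τ`, then `ρ`" and modules are left modules.  When maps are composed from left to right,
the same modules are the right modules over the ring with `(ρ y) (τ z) = (ρ τ) (y ^ τ z)`. -/
abbrev TwistedGroupRing (S : Type u) (T : Type v) [CommRing S] [CommRing T] [Algebra S T] :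
    Type v :=
  SkewMonoidAlgebra T (T ≃ₐ[S] T)

namespace TwistedGroupRing

variable (S : Type u) (T : Type v) [CommRing S] [CommRing T] [Algebra S T]

/-- The action of `Aut_S(T)` on `T` by `S`-linear maps. -/
def autToEnd : (T ≃ₐ[S] T) →* Module.End S T where
  toFun ρ := ρ.toLinearMap
  map_one' := rfl
  map_mul' _ _ := rfl

variable {S T} in
theorem autToEnd_apply (ρ : T ≃ₐ[S] T) (x : T) : autToEnd S T ρ x = ρ x := rfl

/-- The Wedderburn embedding: `y ∈ T` acts by multiplication and `ρ ∈ G` acts as `ρ`. -/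
noncomputable def wedderburn : TwistedGroupRing S T →ₐ[S] Module.End S T :=
  SkewMonoidAlgebra.liftNCAlgHom (Algebra.lmul S T)
    (autToEnd S T) (by intro x y; ext z; simp [autToEnd_apply])

variable {S T} in
theorem wedderburn_single_apply (ρ : T ≃ₐ[S] T) (y x : T) :
    wedderburn S T (SkewMonoidAlgebra.single ρ y) x = y * ρ x := by
  simp [wedderburn, SkewMonoidAlgebra.liftNCAlgHom, SkewMonoidAlgebra.liftNCRingHom, autToEnd_apply]

/-- `T` as a module over the twisted group ring: `(y ρ) • x = y * ρ x`. -/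
noncomputable instance instModuleSelf : Module (TwistedGroupRing S T) T :=
  Module.compHom T (wedderburn S T).toRingHom

variable {S T} in
theorem single_smul (ρ : T ≃ₐ[S] T) (y x : T) :
    (SkewMonoidAlgebra.single ρ y : TwistedGroupRing S T) • x = y * ρ x :=
  wedderburn_single_apply ρ y x

/-- `T` as an object of the category of modules over the twisted group ring. -/
noncomputable abbrev natMod : ModuleCat.{v} (TwistedGroupRing S T) :=
  ModuleCat.of (TwistedGroupRing S T) T

/-- The twisted group ring as a module over itself. -/
noncomputable abbrev freeMod : ModuleCat.{v} (TwistedGroupRing S T) :=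
  ModuleCat.of (TwistedGroupRing S T) (TwistedGroupRing S T)

variable {S T}

/-- The linear endomorphism of the twisted group ring with `1 ↦ a`. -/
noncomputable def endOf (a : TwistedGroupRing S T) : freeMod S T ⟶ freeMod S T :=
  ModuleCat.ofHom (LinearMap.toSpanSingleton (TwistedGroupRing S T) (TwistedGroupRing S T) a)

variable (S) in
/-- The linear map `χ_k` from the twisted group ring to `T` with `1 ↦ t ^ k`. -/
noncomputable def chi (t : T) (k : ℕ) : freeMod S T ⟶ natMod S T :=
  ModuleCat.ofHom (LinearMap.toSpanSingleton (TwistedGroupRing S T) T (t ^ k))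

/-- A projective resolution of `T` over `Ξ`, the twisted group ring, of the form
`⋯ ⟶ Ξ ⟶ Ξ ⟶ Ξ ⟶ Ξ ⟶ 0`, where the maps are `…, α, β, α, β`, given by `1 ↦ α` and `1 ↦ β`,
with augmentation `χ_0 : 1 ↦ 1` from `Ξ` in degree `0` to `T`. -/
structure PeriodicResolution (α β : TwistedGroupRing S T) where
  /-- the projective resolution -/
  res : ProjectiveResolution (natMod S T)
  /-- its terms are the free module of rank one -/
  term : ∀ n : ℕ, res.complex.X n ≅ freeMod S T
  d_even : ∀ n : ℕ, Even n →
    res.complex.d (n + 1) n ≫ (term n).hom = (term (n + 1)).hom ≫ endOf β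
  d_odd : ∀ n : ℕ, Odd n →
    res.complex.d (n + 1) n ≫ (term n).hom = (term (n + 1)).hom ≫ endOf α
  aug : res.π.f 0 ≫ (HomologicalComplex.singleObjXSelf (ComplexShape.down ℕ) 0 (natMod S T)).hom =
    (term 0).hom ≫ ModuleCat.ofHom (LinearMap.toSpanSingleton (TwistedGroupRing S T) T 1)

/-- `f` is an `n`-cocycle of the complex `Hom_Ξ(P, T)`. -/
abbrev PeriodicResolution.IsCocycle {α β : TwistedGroupRing S T} (P : PeriodicResolution α β)
    (n : ℕ) (f : freeMod S T ⟶ natMod S T) : Prop :=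
  P.res.complex.d (n + 1) n ≫ (P.term n).hom ≫ f = 0

/-- The element of `Ext^n(T, T)` represented by an `n`-cocycle `f`. -/
noncomputable def PeriodicResolution.extClass {α β : TwistedGroupRing S T}
    (P : PeriodicResolution α β) (n : ℕ) (f : freeMod S T ⟶ natMod S T) (hf : P.IsCocycle n f) :
    Ext (natMod S T) (natMod S T) n :=
  P.res.extMk ((P.term n).hom ≫ f) (n + 1) rfl hf

end TwistedGroupRing

/-! Write `ρ t = t (1 + t^b u_ρ)`. An element `f = ∑ y_ρ ρ` of `Ξ` satisfies `f • t^l = t^l z_l`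
with `z_l = ∑ y_ρ (1 + t^b u_ρ)^l`, so the `k`-th forward difference of `z` at `0` is `t^(bk) ∑ y_ρ
u_ρ^k`. Differences of distinct `u_ρ` are units, so the Vandermonde matrix `(u_ρ^k)` is invertible
and the sums `∑ y_ρ u_ρ^k`, `k < p`, are free coordinates on `Ξ`. Hence a sequence `z` comes from
`Ξ` exactly when `t^(bk)` divides its `k`-th difference at `0` for all `k < p` (`fwdDiff_iter_mult`,
`exists_smul_pow_eq`). Sequences divisible by `t^((p-1)b)` always qualify. The derivative of the
minimal polynomial of `t` shows that `p` is a multiple of `t^((p-1)b)` and that `s / t^p` is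
congruent to `1` modulo it, so replacing `t^p` by `s` costs only harmless errors. This produces `α`
and `β`.

Exactness: modulo `t`, the coordinates of `β^i`, `1 ≤ i < p`, form `i!` times the `i`-th unit
vector, so Nakayama identifies the annihilator of `1 ∈ T` with `Ξβ` (`exists_eq_mul_beta`). If `f β
= 0`, then `f` kills every `t^l` except the one with `l = b % p`, and the `(p-1)`-st difference
makes its value there divisible enough for `f ∈ Tα` (`exists_eq_mul_alpha`).

Under `Hom_Ξ(Ξ, T) = T` the differentials become the actions of `α` and `β` on `T`. Each sends every
`t^l` to a multiple of a power of `t`, so kernels, images and quotients can be read off. -/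

namespace PurelyRamified

/-! ### Valuations in a totally ramified extension -/

section Valuation

variable {S : Type u} {T : Type v} [CommRing S] [IsDomain S] [IsDiscreteValuationRing S]
  [CommRing T] [IsDomain T] [IsDiscreteValuationRing T] [Algebra S T]
  {p : ℕ} {t : T}

theorem associated_algebraMap_pow
    (hram : (IsLocalRing.maximalIdeal S).map (algebraMap S T) = IsLocalRing.maximalIdeal T ^ p)
    (ht : Irreducible t) {ϖ : S} (hϖ : Irreducible ϖ) :
    Associated (algebraMap S T ϖ) (t ^ p) := by
  rw [hϖ.maximalIdeal_eq, ht.maximalIdeal_eq, Ideal.map_span, Set.image_singleton,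
    Ideal.span_singleton_pow] at hram
  exact Ideal.span_singleton_eq_span_singleton.1 hram

theorem exists_associated_algebraMap
    (hram : (IsLocalRing.maximalIdeal S).map (algebraMap S T) = IsLocalRing.maximalIdeal T ^ p)
    (ht : Irreducible t) {a : S} (ha : a ≠ 0) :
    ∃ m : ℕ, Associated (algebraMap S T a) (t ^ (p * m)) := by
  obtain ⟨ϖ, hϖ⟩ := exists_irreducible S
  obtain ⟨m, hm⟩ := associated_pow_irreducible ha hϖ
  refine ⟨m, ?_⟩
  have h := hm.map (algebraMap S T)
  rw [map_pow] at h
  rw [pow_mul]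
  exact h.trans ((associated_algebraMap_pow hram ht hϖ).pow_pow)

omit [IsDiscreteValuationRing T] in
theorem pow_dvd_pow_iff_le (ht : Irreducible t) {m n : ℕ} : t ^ m ∣ t ^ n ↔ m ≤ n :=
  pow_dvd_pow_iff ht.ne_zero ht.not_isUnit

/-- Nonzero elements of `S` have valuation in `T` divisible by `p`, so the value `n` cannot be
attained. -/
theorem pow_succ_dvd_algebraMap
    (hram : (IsLocalRing.maximalIdeal S).map (algebraMap S T) = IsLocalRing.maximalIdeal T ^ p)
    (ht : Irreducible t) {n : ℕ} (hn : ¬ p ∣ n) {a : S} (h : t ^ n ∣ algebraMap S T a) :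
    t ^ (n + 1) ∣ algebraMap S T a := by
  by_cases ha : a = 0
  · simp [ha]
  obtain ⟨m, hm⟩ := exists_associated_algebraMap hram ht ha
  rw [hm.dvd_iff_dvd_right, pow_dvd_pow_iff_le ht] at h ⊢
  rcases h.lt_or_eq with h | rfl
  · exact h
  · exact absurd (dvd_mul_right _ _) hn

/-- The terms of `∑ aᵢ tⁱ`, with `aᵢ ∈ S` and `i < p`, have pairwise distinct valuations. -/
theorem pow_dvd_of_pow_dvd_sum
    (hram : (IsLocalRing.maximalIdeal S).map (algebraMap S T) = IsLocalRing.maximalIdeal T ^ p)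
    (ht : Irreducible t) (a : Fin p → S) (N : ℕ)
    (h : t ^ N ∣ ∑ i, algebraMap S T (a i) * t ^ (i : ℕ)) (i : Fin p) :
    t ^ N ∣ algebraMap S T (a i) * t ^ (i : ℕ) := by
  induction N generalizing i with
  | zero => simp
  | succ N ih =>
    replace ih := ih ((pow_dvd_pow t N.le_succ).trans h)
    -- Only the index congruent to `N` modulo `p` can give a term of valuation exactly `N`. All
    -- others gain a factor `t`, and the remaining one then gains it from the whole sum.
    have key : ∀ j : Fin p, (j : ℕ) ≠ N % p → t ^ (N + 1) ∣ algebraMap S T (a j) * t ^ (j : ℕ) := by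
      intro j hj
      rcases lt_or_ge N j with hlt | hge
      · exact (pow_dvd_pow t hlt).mul_left _
      · obtain ⟨d, rfl⟩ := Nat.exists_eq_add_of_le hge
        have h1 := ih j
        rw [add_comm, pow_add, mul_dvd_mul_iff_right (pow_ne_zero _ ht.ne_zero)] at h1
        have hd : ¬ p ∣ d := by
          rintro ⟨c, rfl⟩
          rw [Nat.add_mul_mod_self_left, Nat.mod_eq_of_lt j.2] at hj
          exact hj rfl
        rw [show (j : ℕ) + d + 1 = d + 1 + j by ring, pow_add]
        exact mul_dvd_mul (pow_succ_dvd_algebraMap hram ht hd h1) dvd_rfl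
    by_cases hi : (i : ℕ) = N % p
    · rw [← Finset.add_sum_erase _ _ (Finset.mem_univ i)] at h
      refine (dvd_add_left (Finset.dvd_sum fun j hj ↦ key j fun hj' ↦ ?_)).1 h
      exact (Finset.ne_of_mem_erase hj) (Fin.ext (hj'.trans hi.symm))
    · exact key i hi

theorem eq_zero_of_forall_pow_dvd (ht : Irreducible t) {x : T} (h : ∀ n : ℕ, t ^ n ∣ x) :
    x = 0 := by
  by_contra hx
  obtain ⟨n, hn⟩ := associated_pow_irreducible hx ht
  have := h (n + 1)
  rw [hn.dvd_iff_dvd_right, pow_dvd_pow_iff_le ht] at this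
  omega

theorem isUnit_natCast [CharP (IsLocalRing.ResidueField S) p] {l : ℕ} (h : ¬ p ∣ l) :
    IsUnit (l : S) := by
  rw [← IsLocalRing.residue_ne_zero_iff_isUnit, map_natCast, Ne,
    CharP.cast_eq_zero_iff (IsLocalRing.ResidueField S) p]
  exact h

omit [IsDomain S] [IsDiscreteValuationRing S] [IsDomain T] [IsDiscreteValuationRing T] in
theorem mem_maximalIdeal_of_dvd_algebraMap [IsLocalRing S] (ht : Irreducible t) {a : S} (h : t ∣ algebraMap S T a) :
    a ∈ IsLocalRing.maximalIdeal S := by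
  rw [IsLocalRing.mem_maximalIdeal, mem_nonunits_iff]
  intro hu
  exact ht.not_isUnit (isUnit_of_dvd_unit h (hu.map (algebraMap S T)))

end Valuation

/-! ### The powers of `t` as a basis -/

section Basis

variable {S : Type u} {T : Type v} [CommRing S] [IsDomain S] [IsDiscreteValuationRing S]
  [CommRing T] [IsDomain T] [IsDiscreteValuationRing T] [Algebra S T] [Module.Finite S T]
  {p : ℕ} {t : T}

/-- Distinct valuations give independence over `S` and also over the residue field in `T / mT`,
where `mT = (t^p)`. That quotient has dimension `p`, so the powers span it, and Nakayama lifts the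
spanning to `T`. -/
theorem exists_basis_pow (K L : Type*) [Field K] [Field L] [Algebra S K] [Algebra T L] [Algebra K L]
    [Algebra S L] [IsScalarTower S K L] [IsScalarTower S T L] [IsFractionRing S K]
    [IsFractionRing T L] (hp : p ≠ 0) (hdeg : Module.finrank K L = p)
    (hram : (IsLocalRing.maximalIdeal S).map (algebraMap S T) = IsLocalRing.maximalIdeal T ^ p)
    (ht : Irreducible t) :
    ∃ B : Module.Basis (Fin p) S T, ∀ i, B i = t ^ (i : ℕ) := by
  have hinj : Function.Injective (algebraMap S T) := by
    have := FaithfulSMul.of_field_isFractionRing S T K L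
    exact FaithfulSMul.algebraMap_injective S T
  set m := IsLocalRing.maximalIdeal S with hm
  have hmT : m.map (algebraMap S T) = Ideal.span {t ^ p} := by
    rw [hram, ht.maximalIdeal_eq, Ideal.span_singleton_pow]
  have hli : LinearIndependent S fun i : Fin p ↦ t ^ (i : ℕ) := by
    rw [Fintype.linearIndependent_iff]
    intro a ha i
    simp only [Algebra.smul_def] at ha
    have h0 : algebraMap S T (a i) * t ^ (i : ℕ) = 0 :=
      eq_zero_of_forall_pow_dvd ht fun n ↦
        pow_dvd_of_pow_dvd_sum hram ht a n (ha ▸ dvd_zero _) i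
    have h1 := (mul_eq_zero.1 h0).resolve_right (pow_ne_zero _ ht.ne_zero)
    exact hinj (h1.trans (map_zero _).symm)
  have hlik : LinearIndependent (S ⧸ m)
      fun i : Fin p ↦ Ideal.Quotient.mk (m.map (algebraMap S T)) (t ^ (i : ℕ)) := by
    rw [Fintype.linearIndependent_iff]
    intro g hg i
    choose a ha using fun i ↦ Ideal.Quotient.mk_surjective (g i)
    obtain rfl : (fun i ↦ Ideal.Quotient.mk m (a i)) = g := funext ha
    have h1 : Ideal.Quotient.mk (m.map (algebraMap S T))
        (∑ i, algebraMap S T (a i) * t ^ (i : ℕ)) = 0 := by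
      rw [← hg, map_sum]
      refine Finset.sum_congr rfl fun j _ ↦ ?_
      rw [map_mul, Algebra.smul_def]
      rfl
    rw [Ideal.Quotient.eq_zero_iff_mem, hmT, Ideal.mem_span_singleton] at h1
    have h2 := pow_dvd_of_pow_dvd_sum hram ht a p h1 i
    have h3 : t ∣ algebraMap S T (a i) := by
      obtain ⟨d, hd⟩ := Nat.exists_eq_add_of_lt i.2
      have h4 : t ^ (d + 1) * t ^ (i : ℕ) ∣ algebraMap S T (a i) * t ^ (i : ℕ) := by
        rw [← pow_add]
        exact (pow_dvd_pow t (by omega)).trans h2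
      exact (dvd_pow_self t d.succ_ne_zero).trans
        ((mul_dvd_mul_iff_right (pow_ne_zero _ ht.ne_zero)).1 h4)
    exact Ideal.Quotient.eq_zero_iff_mem.2 (mem_maximalIdeal_of_dvd_algebraMap ht h3)
  have hspank : Submodule.span (S ⧸ m) (Set.range
      fun i : Fin p ↦ Ideal.Quotient.mk (m.map (algebraMap S T)) (t ^ (i : ℕ))) = ⊤ := by
    have hfr : Module.finrank (S ⧸ m) (T ⧸ m.map (algebraMap S T)) = p := by
      rw [Ideal.finrank_quotient_map m K L, hdeg]
    have : Nonempty (Fin p) := ⟨⟨0, Nat.pos_of_ne_zero hp⟩⟩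
    let : Field (S ⧸ m) := Ideal.Quotient.field m
    exact hlik.span_eq_top_of_card_eq_finrank (by rw [Fintype.card_fin, hfr])
  have hspan : ⊤ ≤ Submodule.span S (Set.range fun i : Fin p ↦ t ^ (i : ℕ)) := by
    refine Submodule.le_of_le_smul_of_le_jacobson_bot (I := m) Module.Finite.fg_top
      (IsLocalRing.maximalIdeal_le_jacobson _) fun x _ ↦ ?_
    have hx : Ideal.Quotient.mk (m.map (algebraMap S T)) x ∈ Submodule.span (S ⧸ m) (Set.range
      fun i : Fin p ↦ Ideal.Quotient.mk (m.map (algebraMap S T)) (t ^ (i : ℕ))) :=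
      hspank ▸ Submodule.mem_top
    obtain ⟨c, hc⟩ := (Submodule.mem_span_range_iff_exists_fun _).1 hx
    choose a ha using fun i ↦ Ideal.Quotient.mk_surjective (c i)
    obtain rfl : (fun i ↦ Ideal.Quotient.mk m (a i)) = c := funext ha
    have h1 : Ideal.Quotient.mk (m.map (algebraMap S T))
        (∑ i, a i • t ^ (i : ℕ)) = Ideal.Quotient.mk (m.map (algebraMap S T)) x := by
      rw [← hc, map_sum]
      refine Finset.sum_congr rfl fun j _ ↦ ?_
      rw [Algebra.smul_def, map_mul, Algebra.smul_def]
      rfl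
    rw [eq_comm, Ideal.Quotient.eq] at h1
    rw [← add_sub_cancel (∑ i, a i • t ^ (i : ℕ)) x]
    refine Submodule.add_mem_sup (Submodule.sum_mem _ fun i _ ↦
      Submodule.smul_mem _ _ (Submodule.subset_span ⟨i, rfl⟩)) ?_
    rw [Ideal.smul_top_eq_map]
    exact h1
  exact ⟨Module.Basis.mk hli hspan, fun i ↦ Module.Basis.mk_apply hli hspan i⟩

end Basis

end PurelyRamified

/-- A purely ramified Galois extension of degree `p` with ramification number `b`, with uniformizer
`t` above and `s` below, described by the expansions `ρ t = t (1 + t ^ b u_ρ)`. -/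
structure RamificationData (S : Type u) (T : Type v) [CommRing S] [CommRing T] [Algebra S T]
    (p b : ℕ) (t : T) (s : S) where
  /-- the basis `t ^ 0, …, t ^ (p - 1)` -/
  basis : Module.Basis (Fin p) S T
  basis_apply : ∀ i, basis i = t ^ (i : ℕ)
  /-- the coefficient `u_ρ` -/
  coeff : (T ≃ₐ[S] T) → T
  apply_eq : ∀ ρ, ρ t = t * (1 + t ^ b * coeff ρ)
  isUnit_sub : ∀ ρ τ, ρ ≠ τ → IsUnit (coeff ρ - coeff τ)
  card_eq : Nat.card (T ≃ₐ[S] T) = p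
  prime : p.Prime
  irreducible : Irreducible t
  one_le : 1 ≤ b
  isUnit_natCast : ∀ l : ℕ, ¬ p ∣ l → IsUnit (l : S)
  /-- a consequence of the valuation of the different -/
  pow_dvd_prime : t ^ ((p - 1) * b) ∣ (p : T)
  algebraMap_eq : ∃ r, algebraMap S T s = t ^ p * (1 + t ^ ((p - 1) * b) * r)

/-! ### The Galois action modulo `t` -/

namespace PurelyRamified

section Galois

variable {S : Type u} {T : Type v} [CommRing S] [CommRing T] [Algebra S T] {p b : ℕ} {t : T}

theorem dvd_apply_sub_self (B : Module.Basis (Fin p) S T) (hB : ∀ i, B i = t ^ (i : ℕ))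
    {σ : T ≃ₐ[S] T} (hσ : t ∣ σ t - t) (x : T) : t ∣ σ x - x := by
  have hx : σ x - x = ∑ i, B.repr x i • (σ t ^ (i : ℕ) - t ^ (i : ℕ)) := by
    conv_lhs => rw [← B.sum_repr x]
    simp only [hB, map_sum, map_smul, map_pow, ← Finset.sum_sub_distrib, smul_sub]
  rw [hx]
  refine Finset.dvd_sum fun i _ ↦ ?_
  rw [Algebra.smul_def]
  exact (hσ.trans (sub_dvd_pow_sub_pow _ _ _)).mul_left _

/-- The leading coefficient is additive in the exponent because `σ` acts trivially modulo `t`. -/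
theorem exists_pow_apply_eq (hb1 : 1 ≤ b) {σ : T ≃ₐ[S] T} {u₀ : T}
    (hσ : σ t = t * (1 + t ^ b * u₀)) (hres : ∀ x, t ∣ σ x - x) (k : ℕ) :
    ∃ v, (σ ^ k) t = t * (1 + t ^ b * v) ∧ t ∣ v - k * u₀ := by
  induction k with
  | zero => exact ⟨0, by simp, by simp⟩
  | succ k ih =>
    obtain ⟨v, hv, hvk⟩ := ih
    -- Obtained by applying `σ` to `t (1 + t^b v)`: one factor `1 + t^b u₀` comes from `σ t` and `b`
    -- more from `(σ t)^b`.
    refine ⟨u₀ + (1 + t ^ b * u₀) ^ (b + 1) * σ v, ?_, ?_⟩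
    · rw [pow_succ', AlgEquiv.mul_apply, hv, map_mul, map_add, map_mul, map_one, map_pow, hσ,
        mul_pow]
      ring
    · have h1 : t ∣ (1 + t ^ b * u₀) ^ (b + 1) - 1 := by
        have h2 := sub_dvd_pow_sub_pow (1 + t ^ b * u₀) 1 (b + 1)
        rw [one_pow, add_sub_cancel_left] at h2
        exact ((dvd_pow_self t (by omega)).mul_right _).trans h2
      have h3 : u₀ + (1 + t ^ b * u₀) ^ (b + 1) * σ v - ((k + 1 : ℕ) : T) * u₀
          = ((1 + t ^ b * u₀) ^ (b + 1) - 1) * σ v + (σ v - v) + (v - k * u₀) := by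
        push_cast
        ring
      rw [h3]
      exact dvd_add (dvd_add (h1.mul_right _) (hres v)) hvk

/-- For distinct powers of `σ` whose exponents differ by `d`, the difference is `± d u₀` modulo `t`,
and `p ∤ d`. -/
theorem isUnit_sub_of_zpowers_eq_top [IsLocalRing T] (hp : p.Prime)
    (hcard : Nat.card (T ≃ₐ[S] T) = p) (ht : t ∈ IsLocalRing.maximalIdeal T)
    (hunit : ∀ l : ℕ, ¬ p ∣ l → IsUnit (l : S))
    {σ : T ≃ₐ[S] T} (hgen : Subgroup.zpowers σ = ⊤) {u₀ : T} (hu₀ : IsUnit u₀)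
    {v : (T ≃ₐ[S] T) → T} (hv : ∀ k : ℕ, t ∣ v (σ ^ k) - k * u₀)
    {ρ τ : T ≃ₐ[S] T} (hne : ρ ≠ τ) : IsUnit (v ρ - v τ) := by
  have hfin : Finite (T ≃ₐ[S] T) := Nat.finite_of_card_ne_zero (hcard ▸ hp.ne_zero)
  have hpow : ∀ g : T ≃ₐ[S] T, ∃ k : ℕ, σ ^ k = g := fun g ↦
    mem_powers_iff_mem_zpowers.2 (hgen ▸ Subgroup.mem_top g)
  have hord : σ ^ p = 1 := hcard ▸ pow_card_eq_one'
  have key : ∀ i d : ℕ, σ ^ (i + d) ≠ σ ^ i → IsUnit (v (σ ^ (i + d)) - v (σ ^ i)) := by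
    intro i d hid
    have hd : ¬ p ∣ d := by
      rintro ⟨c, rfl⟩
      rw [pow_add, pow_mul, hord, one_pow, mul_one] at hid
      exact hid rfl
    have h1 : IsUnit ((d : T) * u₀) := by
      have h := (hunit d hd).map (algebraMap S T)
      rw [map_natCast] at h
      exact h.mul hu₀
    have h2 : v (σ ^ (i + d)) - v (σ ^ i) = (d : T) * u₀ +
        ((v (σ ^ (i + d)) - (i + d : ℕ) * u₀) - (v (σ ^ i) - i * u₀)) := by
      push_cast
      ring
    rw [h2]
    by_contra hcon
    have h3 : (v (σ ^ (i + d)) - (i + d : ℕ) * u₀) - (v (σ ^ i) - i * u₀) ∈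
        IsLocalRing.maximalIdeal T :=
      Ideal.mem_of_dvd _ (dvd_sub (hv _) (hv _)) ht
    have h4 := Ideal.sub_mem _ ((IsLocalRing.mem_maximalIdeal _).2 hcon) h3
    rw [add_sub_cancel_right] at h4
    exact h4 h1
  obtain ⟨i, rfl⟩ := hpow ρ
  obtain ⟨j, rfl⟩ := hpow τ
  rcases le_total i j with h | h
  · obtain ⟨d, rfl⟩ := Nat.exists_eq_add_of_le h
    rw [← neg_sub]
    exact (key i d hne.symm).neg
  · obtain ⟨d, rfl⟩ := Nat.exists_eq_add_of_le h
    exact key j d hne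

theorem card_algEquiv_eq (K L : Type*) [Field K] [Field L] [IsDomain S] [IsIntegrallyClosed S]
    [IsDomain T] [IsIntegrallyClosed T] [Algebra S K] [Algebra T L]
    [Algebra K L] [Algebra S L] [IsScalarTower S K L] [IsScalarTower S T L] [IsFractionRing S K]
    [IsFractionRing T L] [Module.Finite S T] [FiniteDimensional K L] [IsGalois K L] :
    Nat.card (T ≃ₐ[S] T) = Module.finrank K L := by
  have : IsIntegralClosure T S L := IsIntegralClosure.of_isIntegrallyClosed T S L
  rw [← IsGalois.card_aut_eq_finrank K L]
  exact (Nat.card_congr (galRestrict S K L T).toEquiv).symm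

end Galois

/-! ### The derivative of the minimal polynomial -/

section Different

variable {S : Type u} {T : Type v} [CommRing S] [IsDomain S] [IsDiscreteValuationRing S]
  [CommRing T] [IsDomain T] [IsDiscreteValuationRing T] [Algebra S T]
  {p b : ℕ} {t : T}

omit [IsDomain S] [IsDiscreteValuationRing S] in
open Polynomial in
-- The distinct conjugates `ρ t` are roots, so `∏ (X - ρ t)` divides the minimal polynomial. The
-- derivative at `t` is therefore a multiple of `∏_{ρ ≠ 1} (t - ρ t)`.
theorem pow_dvd_aeval_derivative_minpoly [Finite (T ≃ₐ[S] T)] (hint : IsIntegral S t)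
    (hinj : Function.Injective fun ρ : T ≃ₐ[S] T ↦ ρ t) {c : T}
    (hc : ∀ ρ : T ≃ₐ[S] T, c ∣ t - ρ t) :
    c ^ (Nat.card (T ≃ₐ[S] T) - 1) ∣ aeval t (derivative (minpoly S t)) := by
  classical
  have := Fintype.ofFinite (T ≃ₐ[S] T)
  set g := (minpoly S t).map (algebraMap S T) with hg
  have hg0 : g ≠ 0 := ((minpoly.monic hint).map _).ne_zero
  have hroot : ∀ ρ : T ≃ₐ[S] T, ρ t ∈ g.roots := by
    intro ρ
    rw [mem_roots hg0, IsRoot.def, hg, eval_map_algebraMap, aeval_algHom_apply, minpoly.aeval,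
      map_zero]
  have hle : (Finset.univ.val.map fun ρ : T ≃ₐ[S] T ↦ ρ t) ≤ g.roots :=
    (Multiset.le_iff_subset (Finset.univ.nodup.map hinj)).2 fun x hx ↦ by
      obtain ⟨ρ, _, rfl⟩ := Multiset.mem_map.1 hx
      exact hroot ρ
  obtain ⟨q, hq⟩ := (Multiset.prod_X_sub_C_dvd_iff_le_roots hg0 _).2 hle
  have hq' : g = (X - C t) * ((∏ ρ ∈ Finset.univ.erase (1 : T ≃ₐ[S] T), (X - C (ρ t))) * q) := by
    rw [hq, Multiset.map_map, ← mul_assoc]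
    congr 1
    exact (Finset.mul_prod_erase Finset.univ (fun ρ : T ≃ₐ[S] T ↦ X - C (ρ t))
      (Finset.mem_univ 1)).symm
  have h1 : aeval t (derivative (minpoly S t)) =
      (∏ ρ ∈ Finset.univ.erase (1 : T ≃ₐ[S] T), (t - ρ t)) * q.eval t := by
    rw [← eval_map_algebraMap, ← derivative_map, ← hg, hq', derivative_mul]
    simp [eval_prod]
  rw [h1, Nat.card_eq_fintype_card, ← Finset.card_univ,
    ← Finset.card_erase_of_mem (Finset.mem_univ (1 : T ≃ₐ[S] T)), ← Finset.prod_const]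
  exact (Finset.prod_dvd_prod_of_dvd _ _ fun ρ _ ↦ hc ρ).mul_right _

open Polynomial in
-- The terms `j a_j t^(j-1)` of the derivative have separate valuations, so each is divisible by
-- `t^N`. The leading term yields the statement on `p`. For `0 < j < p` the factor `j` is a unit and
-- drops out, which bounds the middle terms of `g`.
theorem pow_dvd_of_pow_dvd_aeval_derivative
    (hram : (IsLocalRing.maximalIdeal S).map (algebraMap S T) = IsLocalRing.maximalIdeal T ^ p)
    (ht : Irreducible t) (hp : 0 < p) (hunit : ∀ l : ℕ, ¬ p ∣ l → IsUnit (l : S))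
    {g : S[X]} (hg : g.Monic) (hdeg : g.natDegree = p) {N : ℕ}
    (h : t ^ N ∣ aeval t (derivative g)) :
    t ^ N ∣ (p : T) * t ^ (p - 1) ∧
      t ^ (N + 1) ∣ aeval t g - t ^ p - algebraMap S T (g.coeff 0) := by
  have h1 : aeval t (derivative g) =
      ∑ j : Fin p, algebraMap S T (g.coeff (j + 1) * (j + 1)) * t ^ (j : ℕ) := by
    rw [Fin.sum_univ_eq_sum_range
      (fun j ↦ algebraMap S T (g.coeff (j + 1) * (j + 1)) * t ^ j), aeval_eq_sum_range'
      (n := p) ((natDegree_derivative_lt (by omega)).trans_eq hdeg)]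
    exact Finset.sum_congr rfl fun j _ ↦ by rw [coeff_derivative, Algebra.smul_def]
  rw [h1] at h
  have h2 := pow_dvd_of_pow_dvd_sum hram ht _ N h
  constructor
  · have h3 := h2 ⟨p - 1, by omega⟩
    have h4 : g.coeff p = 1 := hdeg ▸ hg
    have h5 : ((p - 1 : ℕ) : S) + 1 = (p : S) := by exact_mod_cast congrArg _ (by omega)
    simpa [Nat.sub_add_cancel hp, h4, h5, -Nat.cast_sub] using h3
  · obtain ⟨n, rfl⟩ : ∃ n, p = n + 1 := ⟨p - 1, by omega⟩
    have h3 : aeval t g - t ^ (n + 1) - algebraMap S T (g.coeff 0) =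
        ∑ j ∈ Finset.range n, algebraMap S T (g.coeff (j + 1)) * t ^ (j + 1) := by
      rw [aeval_eq_sum_range, hdeg, Finset.sum_range_succ, Finset.sum_range_succ', ← hdeg,
        hg.coeff_natDegree]
      simp [Algebra.smul_def]
    rw [h3]
    refine Finset.dvd_sum fun j hj ↦ ?_
    have hj' := Finset.mem_range.1 hj
    have h4 := h2 ⟨j, by omega⟩
    have h5 : IsUnit (algebraMap S T ((j + 1 : ℕ) : S)) :=
      (hunit _ fun hd ↦ by have := Nat.le_of_dvd (by omega) hd; omega).map _
    have h6 : t ^ N ∣ algebraMap S T (g.coeff (j + 1)) * t ^ j := by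
      rw [← h5.dvd_mul_right]
      convert h4 using 1
      simp only [map_mul, map_add, map_natCast, map_one]
      push_cast
      ring
    rw [pow_succ, pow_succ, ← mul_assoc]
    exact mul_dvd_mul_right h6 t

end Different

theorem nonempty_ramificationData
    {S : Type u} {T : Type v} (K L : Type*) [CommRing S] [IsDomain S] [IsDiscreteValuationRing S]
    [CommRing T] [IsDomain T] [IsDiscreteValuationRing T] [Field K] [Field L]
    [Algebra S T] [Algebra S K] [Algebra T L] [Algebra K L] [Algebra S L]
    [IsScalarTower S K L] [IsScalarTower S T L] [IsFractionRing S K] [IsFractionRing T L]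
    [Module.Finite S T] [IsGalois K L]
    (p : ℕ) (hp : p.Prime) (hp3 : 3 ≤ p) [CharP (IsLocalRing.ResidueField S) p]
    (hdeg : Module.finrank K L = p)
    (hram : (IsLocalRing.maximalIdeal S).map (algebraMap S T) = IsLocalRing.maximalIdeal T ^ p)
    (σ : T ≃ₐ[S] T) (hσ : Subgroup.zpowers σ = ⊤)
    (t : T) (ht : Irreducible t)
    (s : S) (hs : s = (-1) ^ (p + 1) * Algebra.norm S t)
    (b : ℕ) (hb : addVal T (σ t - t) = (b : ℕ∞) + 1) (hb1 : 1 ≤ b) :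
    Nonempty (RamificationData S T p b t s) := by
  obtain ⟨B, hB⟩ := exists_basis_pow K L hp.ne_zero hdeg hram ht
  have hcard : Nat.card (T ≃ₐ[S] T) = p := by
    have : FiniteDimensional K L := Module.finite_of_finrank_pos (hdeg ▸ hp.pos)
    exact (card_algEquiv_eq K L).trans hdeg
  have hfin : Finite (T ≃ₐ[S] T) := Nat.finite_of_card_ne_zero (hcard ▸ hp.ne_zero)
  have hunit : ∀ l : ℕ, ¬ p ∣ l → IsUnit (l : S) := fun l hl ↦ isUnit_natCast hl
  have htm : t ∈ IsLocalRing.maximalIdeal T :=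
    (IsLocalRing.mem_maximalIdeal _).2 ht.not_isUnit
  obtain ⟨w, hw⟩ : Associated (t ^ (b + 1)) (σ t - t) := by
    rw [← addVal_eq_iff_associated, ht.addVal_pow, hb]
    rfl
  have hσt : σ t = t * (1 + t ^ b * w) := by
    rw [← sub_add_cancel (σ t) t, ← hw]
    ring
  have hres := dvd_apply_sub_self B hB (σ := σ) ⟨t ^ b * w, by rw [hσt]; ring⟩
  have hpow : ∀ g : T ≃ₐ[S] T, ∃ k : ℕ, σ ^ k = g := fun g ↦
    mem_powers_iff_mem_zpowers.2 (hσ ▸ Subgroup.mem_top g)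
  have hex : ∀ ρ : T ≃ₐ[S] T, ∃ v, ρ t = t * (1 + t ^ b * v) := fun ρ ↦ by
    obtain ⟨k, rfl⟩ := hpow ρ
    exact (exists_pow_apply_eq hb1 hσt hres k).imp fun _ h ↦ h.1
  choose v hv using hex
  have hvk : ∀ k : ℕ, t ∣ v (σ ^ k) - k * w := by
    intro k
    obtain ⟨v', h1, h2⟩ := exists_pow_apply_eq hb1 hσt hres k
    rw [hv] at h1
    have h3 := mul_left_cancel₀ (pow_ne_zero b ht.ne_zero)
      (add_left_cancel (mul_left_cancel₀ ht.ne_zero h1))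
    rwa [h3]
  have hsub : ∀ ρ τ, ρ ≠ τ → IsUnit (v ρ - v τ) := fun ρ τ hne ↦
    isUnit_sub_of_zpowers_eq_top hp hcard htm hunit hσ w.isUnit hvk hne
  have hinj : Function.Injective fun ρ : T ≃ₐ[S] T ↦ ρ t := by
    intro ρ τ hρτ
    by_contra hne
    have h := hsub ρ τ hne
    simp only [hv] at hρτ
    rw [mul_left_cancel₀ (pow_ne_zero b ht.ne_zero)
      (add_left_cancel (mul_left_cancel₀ ht.ne_zero hρτ)), sub_self] at h
    exact not_isUnit_zero h
  let pb : PowerBasis S T := ⟨t, p, B, hB⟩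
  have hint : IsIntegral S t := Algebra.IsIntegral.isIntegral t
  have hnat : (minpoly S t).natDegree = p := pb.natDegree_minpoly
  have hnorm : Algebra.norm S t = (-1) ^ p * (minpoly S t).coeff 0 :=
    Algebra.PowerBasis.norm_gen_eq_coeff_zero_minpoly pb
  -- The two signs combine to `(-1)^(2p+1) = -1`.
  have hs' : (minpoly S t).coeff 0 = -s := by
    rw [hs, hnorm, ← mul_assoc, ← pow_add, (show Odd (p + 1 + p) from ⟨p, by ring⟩).neg_one_pow]
    ring
  have hder := pow_dvd_aeval_derivative_minpoly hint hinj (c := t ^ (b + 1)) fun ρ ↦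
    ⟨-v ρ, by rw [hv]; ring⟩
  rw [hcard, ← pow_mul] at hder
  obtain ⟨h1, h2⟩ := pow_dvd_of_pow_dvd_aeval_derivative hram ht hp.pos hunit (minpoly.monic hint)
    hnat hder
  have hN : (b + 1) * (p - 1) = (p - 1) * b + (p - 1) := by ring
  rw [hN, pow_add, mul_dvd_mul_iff_right (pow_ne_zero _ ht.ne_zero)] at h1
  refine ⟨⟨B, hB, v, hv, hsub, hcard, hp, ht, hb1, hunit, h1, ?_⟩⟩
  obtain ⟨r, hr⟩ := h2
  rw [minpoly.aeval, hs', map_neg] at hr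
  refine ⟨r, ?_⟩
  -- The extra `1` completes `t^(p-1)` to the factor `t^p` in the expansion of `s`.
  have hN' : (b + 1) * (p - 1) + 1 = (p - 1) * b + p := by
    rw [hN]
    have := hp.pos
    omega
  rw [hN', pow_add] at hr
  linear_combination hr

end PurelyRamified

/-! ### Forward differences -/

section ForwardDifference

/-- Geometric sequences are eigenvectors of the difference operator. With `a = 1 + t^b u_ρ` the
eigenvalue is `t^b u_ρ`. -/
theorem fwdDiff_iter_geometric {A : Type*} [CommRing A] (y a : A) (k : ℕ) :
    (fwdDiff 1)^[k] (fun l : ℕ ↦ y * a ^ l) = fun l ↦ y * (a - 1) ^ k * a ^ l := by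
  induction k with
  | zero => simp
  | succ k ih =>
    rw [Function.iterate_succ_apply', ih]
    funext l
    simp only [fwdDiff]
    ring

theorem fwdDiff_iter_zero_congr {A : Type*} [AddCommGroup A] {f g : ℕ → A} {k : ℕ}
    (h : ∀ l ≤ k, f l = g l) : (fwdDiff 1)^[k] f 0 = (fwdDiff 1)^[k] g 0 := by
  rw [fwdDiff_iter_eq_sum_shift, fwdDiff_iter_eq_sum_shift]
  refine Finset.sum_congr rfl fun l hl ↦ ?_
  rw [h _ (by simpa using Nat.lt_succ_iff.1 (Finset.mem_range.1 hl))]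

theorem eq_sum_choose_mul_fwdDiff_iter {A : Type*} [CommRing A] (f : ℕ → A) (l : ℕ) :
    f l = ∑ k ∈ Finset.range (l + 1), (l.choose k : A) * (fwdDiff 1)^[k] f 0 := by
  have h := shift_eq_sum_fwdDiff_iter (1 : ℕ) f l 0
  simpa [nsmul_eq_mul] using h

end ForwardDifference

/-! ### Coordinates on the twisted group ring -/

namespace RamificationData

open SkewMonoidAlgebra

variable {S : Type u} {T : Type v} [CommRing S] [CommRing T] [Algebra S T]
  {p b : ℕ} {t : T} {s : S} (R : RamificationData S T p b t s)

/-- The `T`-linear form `∑ y_ρ ρ ↦ ∑ y_ρ u_ρ ^ k` on the twisted group ring. -/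
noncomputable def coord (k : ℕ) : TwistedGroupRing S T →ₗ[T] T :=
  basisSingleOne.constr T fun ρ ↦ R.coeff ρ ^ k

theorem coord_single (k : ℕ) (ρ : T ≃ₐ[S] T) (y : T) :
    R.coord k (single ρ y) = y * R.coeff ρ ^ k := by
  have h : (single ρ y : TwistedGroupRing S T) = y • basisSingleOne ρ := by
    exact (congrArg (single ρ) (mul_one y).symm).trans (smul_single y ρ 1).symm
  rw [h, map_smul, coord, Module.Basis.constr_basis, smul_eq_mul]

/-- The `T`-linear form `f ↦ (f • t ^ l) / t ^ l` on the twisted group ring. -/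
noncomputable def mult (l : ℕ) : TwistedGroupRing S T →ₗ[T] T :=
  basisSingleOne.constr T fun ρ ↦ (1 + t ^ b * R.coeff ρ) ^ l

theorem mult_single (l : ℕ) (ρ : T ≃ₐ[S] T) (y : T) :
    R.mult l (single ρ y) = y * (1 + t ^ b * R.coeff ρ) ^ l := by
  have h : (single ρ y : TwistedGroupRing S T) = y • basisSingleOne ρ := by
    exact (congrArg (single ρ) (mul_one y).symm).trans (smul_single y ρ 1).symm
  rw [h, map_smul, mult, Module.Basis.constr_basis, smul_eq_mul]

theorem smul_pow (f : TwistedGroupRing S T) (l : ℕ) : f • t ^ l = t ^ l * R.mult l f := by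
  induction f using SkewMonoidAlgebra.induction_on with
  | zero => simp
  | single ρ y =>
    rw [TwistedGroupRing.single_smul, map_pow, R.apply_eq, mult_single, mul_pow]
    ring
  | add f g hf hg => rw [add_smul, hf, hg, map_add, mul_add]

/-- This links the action on the powers of `t` to the coordinates: each `ρ` contributes a geometric
sequence of ratio `1 + t^b u_ρ`. -/
theorem fwdDiff_iter_mult (f : TwistedGroupRing S T) (k : ℕ) :
    (fwdDiff 1)^[k] (fun l ↦ R.mult l f) 0 = t ^ (b * k) * R.coord k f := by
  induction f using SkewMonoidAlgebra.induction_on with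
  | zero =>
    have h := fwdDiff_iter_geometric (0 : T) 0 k
    simp only [zero_mul] at h
    simp [h]
  | single ρ y =>
    simp only [mult_single, fwdDiff_iter_geometric, coord_single]
    ring
  | add f g hf hg =>
    simp only [map_add, mul_add, ← hf, ← hg]
    exact congrFun (fwdDiff_iter_add 1 (fun l ↦ R.mult l f) (fun l ↦ R.mult l g) k) 0

include R in
theorem finite_algEquiv : Finite (T ≃ₐ[S] T) :=
  Nat.finite_of_card_ne_zero (R.card_eq ▸ R.prime.ne_zero)

/-- The Vandermonde determinant is a product of differences of the `u_ρ`, all of them units. -/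
theorem exists_unit_matrix : ∃ (e : (T ≃ₐ[S] T) ≃ Fin p) (V : Matrix (Fin p) (Fin p) T),
    IsUnit V ∧ ∀ ρ (k : Fin p), V (e ρ) k = R.coeff ρ ^ (k : ℕ) := by
  have := R.finite_algEquiv
  let e := Finite.equivFinOfCardEq R.card_eq
  refine ⟨e, Matrix.vandermonde fun i ↦ R.coeff (e.symm i), ?_, fun ρ k ↦ by
    simp [Matrix.vandermonde_apply]⟩
  rw [Matrix.isUnit_iff_isUnit_det, Matrix.det_vandermonde]
  refine IsUnit.prod_univ_iff.2 fun i ↦ IsUnit.prod_iff.2 fun j hj ↦ R.isUnit_sub _ _ fun h ↦ ?_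
  exact (Finset.mem_Ioi.1 hj).ne' (e.symm.injective h)

theorem coord_eq_sum [Fintype (T ≃ₐ[S] T)] (f : TwistedGroupRing S T) (k : ℕ) :
    R.coord k f = ∑ ρ, f.coeff ρ * R.coeff ρ ^ k := by
  rw [coord, Module.Basis.constr_apply_fintype]
  rfl

theorem ext_coord {f g : TwistedGroupRing S T} (h : ∀ k < p, R.coord k f = R.coord k g) :
    f = g := by
  obtain ⟨e, V, hV, hVe⟩ := R.exists_unit_matrix
  have := R.finite_algEquiv
  have := Fintype.ofFinite (T ≃ₐ[S] T)
  have key : ∀ (f : TwistedGroupRing S T) (k : Fin p),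
      Matrix.vecMul (fun i ↦ f.coeff (e.symm i)) V k = R.coord k f := by
    intro f k
    rw [coord_eq_sum, Matrix.vecMul, dotProduct, ← e.sum_comp]
    simp [hVe]
  have h2 := Matrix.vecMul_injective_of_isUnit hV
    (funext fun k ↦ (key f k).trans ((h k k.2).trans (key g k).symm))
  ext ρ
  simpa using congrFun h2 (e ρ)

theorem exists_coord_eq (w : ℕ → T) :
    ∃ f : TwistedGroupRing S T, ∀ k < p, R.coord k f = w k := by
  obtain ⟨e, V, hV, hVe⟩ := R.exists_unit_matrix
  have := R.finite_algEquiv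
  have := Fintype.ofFinite (T ≃ₐ[S] T)
  obtain ⟨y, hy⟩ := Matrix.vecMul_surjective_iff_isUnit.2 hV fun k : Fin p ↦ w k
  refine ⟨∑ ρ, single ρ (y (e ρ)), fun k hk ↦ ?_⟩
  rw [_root_.map_sum]
  simp only [coord_single]
  have h := congrFun hy ⟨k, hk⟩
  change Matrix.vecMul y V ⟨k, hk⟩ = w k at h
  rw [Matrix.vecMul, dotProduct, ← e.sum_comp] at h
  simpa [hVe] using h

variable [IsDomain T]

theorem fwdDiff_iter_of_smul_pow {f : TwistedGroupRing S T} {z : ℕ → T} {k : ℕ}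
    (h : ∀ l ≤ k, f • t ^ l = t ^ l * z l) : (fwdDiff 1)^[k] z 0 = t ^ (b * k) * R.coord k f := by
  rw [← fwdDiff_iter_mult]
  refine fwdDiff_iter_zero_congr fun l hl ↦ ?_
  have h1 := h l hl
  rw [R.smul_pow] at h1
  exact (mul_left_cancel₀ (pow_ne_zero _ R.irreducible.ne_zero) h1).symm

theorem coord_eq_of_smul_pow {f : TwistedGroupRing S T} {z : ℕ → T} {k : ℕ} {w : T}
    (h : ∀ l ≤ k, f • t ^ l = t ^ l * z l) (hw : (fwdDiff 1)^[k] z 0 = t ^ (b * k) * w) :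
    R.coord k f = w := by
  rw [R.fwdDiff_iter_of_smul_pow h] at hw
  exact mul_left_cancel₀ (pow_ne_zero _ R.irreducible.ne_zero) hw

include R in
theorem ext_smul_pow {f g : TwistedGroupRing S T} (h : ∀ l < p, f • t ^ l = g • t ^ l) :
    f = g := by
  refine R.ext_coord fun k hk ↦ R.coord_eq_of_smul_pow (z := fun l ↦ R.mult l g)
    (fun l hl ↦ ?_) (R.fwdDiff_iter_mult g k)
  rw [h l (hl.trans_lt hk), R.smul_pow]

omit [IsDomain T] in
include R in
/-- The image of the Wedderburn embedding is described by divisibility of iterated forward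
differences. -/
theorem exists_smul_pow_eq {z w : ℕ → T} (h : ∀ k < p, (fwdDiff 1)^[k] z 0 = t ^ (b * k) * w k) :
    ∃ f : TwistedGroupRing S T, ∀ l < p, f • t ^ l = t ^ l * z l := by
  obtain ⟨f, hf⟩ := R.exists_coord_eq w
  refine ⟨f, fun l hl ↦ ?_⟩
  -- Newton's formula recovers the values at `l` from the differences of order at most `l`.
  rw [R.smul_pow, eq_sum_choose_mul_fwdDiff_iter z, eq_sum_choose_mul_fwdDiff_iter
    fun l ↦ R.mult l f]
  congr 1
  refine Finset.sum_congr rfl fun k hk ↦ ?_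
  have hkp : k < p := (Nat.lt_succ_iff.1 (Finset.mem_range.1 hk)).trans_lt hl
  rw [h k hkp, R.fwdDiff_iter_mult, hf k hkp]

end RamificationData

/-! ### Construction of `α` and `β` -/

namespace RamificationData

open SkewMonoidAlgebra

/-- The element of valuation `n` in the form `s ^ q * t ^ r` with `n = p * q + r` and `r < p`. -/
def stdPow {S : Type u} {T : Type v} [CommRing S] [CommRing T] [Algebra S T]
    (p : ℕ) (t : T) (s : S) (n : ℕ) : T :=
  algebraMap S T (s ^ (n / p)) * t ^ (n % p)

section

variable {S : Type u} {T : Type v} [CommRing S] [CommRing T] [Algebra S T]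
  {p b : ℕ} {t : T} {s : S} (R : RamificationData S T p b t s)

theorem stdPow_of_lt {l : ℕ} (hl : l < p) : stdPow p t s l = t ^ l := by
  simp [stdPow, Nat.div_eq_of_lt hl, Nat.mod_eq_of_lt hl]

theorem stdPow_add_mul (hp : 0 < p) (m q : ℕ) :
    stdPow p t s (m + p * q) = algebraMap S T (s ^ q) * stdPow p t s m := by
  rw [stdPow, stdPow, Nat.add_mul_mod_self_left, Nat.add_mul_div_left _ _ hp, pow_add, map_mul]
  ring

theorem stdPow_mod_add (hp : 0 < p) (n m : ℕ) :
    algebraMap S T (s ^ (n / p)) * stdPow p t s (n % p + m) = stdPow p t s (n + m) := by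
  rw [← stdPow_add_mul hp]
  congr 1
  have := Nat.mod_add_div n p
  omega

theorem natCast_mul_stdPow_add (hp : 0 < p) (l b : ℕ) :
    (l : T) * stdPow p t s (l + b) =
      (l : T) * algebraMap S T (s ^ (b / p + (l + b % p) / p)) * t ^ ((l + b % p) % p) := by
  rw [add_comm l b, ← stdPow_mod_add hp, add_comm (b % p) l, stdPow, pow_add, map_mul]
  ring

include R in
-- Trading `t^p` for `s` costs an error of the size absorbed by `exists_smul_pow_eq_of_dvd`.
theorem exists_stdPow_eq (n : ℕ) : ∃ r, stdPow p t s n = t ^ n * (1 + t ^ ((p - 1) * b) * r) := by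
  obtain ⟨r, hr⟩ := R.algebraMap_eq
  have h := sub_dvd_pow_sub_pow (1 + t ^ ((p - 1) * b) * r) 1 (n / p)
  rw [one_pow, add_sub_cancel_left] at h
  obtain ⟨c, hc⟩ := (dvd_mul_right _ _).trans h
  refine ⟨c, ?_⟩
  rw [← hc, add_sub_cancel, stdPow, map_pow, hr, mul_pow, ← pow_mul]
  conv_rhs => rw [← Nat.mod_add_div n p, pow_add]
  rw [Nat.mod_add_div]
  ring

theorem smul_algebraMap_mul (f : TwistedGroupRing S T) (a : S) (x : T) :
    f • (algebraMap S T a * x) = algebraMap S T a * (f • x) := by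
  rw [← Algebra.smul_def, ← Algebra.smul_def]
  exact (TwistedGroupRing.wedderburn S T f).map_smul a x

theorem smul_natCast_mul (f : TwistedGroupRing S T) (n : ℕ) (x : T) :
    f • ((n : T) * x) = n * (f • x) := by
  rw [← map_natCast (algebraMap S T), smul_algebraMap_mul]

theorem single_one_mul_smul (y : T) (f : TwistedGroupRing S T) (x : T) :
    (single 1 y * f) • x = y * (f • x) := by
  rw [mul_smul, TwistedGroupRing.single_smul, AlgEquiv.one_apply]

theorem single_one_mul_eq_smul (y : T) (f : TwistedGroupRing S T) : single 1 y * f = y • f := by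
  induction f using SkewMonoidAlgebra.induction_on with
  | zero => simp
  | single ρ x => rw [single_mul_single, smul_single, one_mul, one_smul, smul_eq_mul]
  | add f g hf hg => rw [mul_add, hf, hg, smul_add]

include R in
theorem isUnit_natCast_top {l : ℕ} (h : ¬ p ∣ l) : IsUnit (l : T) := by
  have h1 := (R.isUnit_natCast l h).map (algebraMap S T)
  rwa [map_natCast] at h1

include R in
-- The exponent `(p-1)b` is the largest of the `bk` with `k < p`, so every divisibility condition
-- holds at once.
theorem exists_smul_pow_eq_of_dvd (z : ℕ → T) :
    ∃ f : TwistedGroupRing S T, ∀ l < p, f • t ^ l = t ^ l * (t ^ ((p - 1) * b) * z l) := by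
  refine R.exists_smul_pow_eq
    (w := fun k ↦ t ^ ((p - 1 - k) * b) * (fwdDiff 1)^[k] z 0) fun k hk ↦ ?_
  have h := congrFun (fwdDiff_iter_const_smul 1 (t ^ ((p - 1) * b)) z k) 0
  refine h.trans ?_
  rw [Pi.smul_apply, smul_eq_mul, ← mul_assoc, ← pow_add]
  congr 2
  rw [mul_comm b, ← add_mul]
  congr 1
  omega

/-- This explains the exponent in `α`: `s^(b - b/p)` divided by `t^(b % p)` has valuation exactly
`(p-1)b`. -/
theorem mul_sub_div (hp : 0 < p) (b : ℕ) : p * (b - b / p) = (p - 1) * b + b % p := by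
  have h1 := Nat.mod_add_div b p
  have h2 : b / p ≤ b := Nat.div_le_self b p
  have h3 : (p - 1) * b + b = p * b := by
    obtain ⟨n, rfl⟩ : ∃ n, p = n + 1 := ⟨p - 1, by omega⟩
    simp [add_mul]
  rw [Nat.mul_sub]
  omega

include R in
theorem exists_alpha : ∃ α : TwistedGroupRing S T, ∀ l < p,
    α • t ^ l = if l = b % p then algebraMap S T (s ^ (b - b / p)) else 0 := by
  obtain ⟨r, hr⟩ := R.exists_stdPow_eq (0 + p * (b - b / p))
  rw [stdPow_add_mul R.prime.pos, stdPow_of_lt R.prime.pos, pow_zero, mul_one, zero_add,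
    mul_sub_div R.prime.pos, pow_add] at hr
  obtain ⟨α, hα⟩ := R.exists_smul_pow_eq_of_dvd
    fun l ↦ if l = b % p then 1 + t ^ ((p - 1) * b) * r else 0
  refine ⟨α, fun l hl ↦ ?_⟩
  rw [hα l hl]
  split_ifs with h
  · rw [hr, h]
    ring
  · simp

theorem fwdDiff_iter_natCast_mul {A : Type*} [CommRing A] (c : A) (k : ℕ) :
    (fwdDiff 1)^[k] (fun l : ℕ ↦ (l : A) * c) 0 = if k = 1 then c else 0 := by
  have h1 : fwdDiff 1 (fun l : ℕ ↦ (l : A) * c) = fun _ ↦ c := by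
    funext l
    simp [fwdDiff, add_mul]
  match k with
  | 0 => simp
  | 1 => simp [h1]
  | k + 2 =>
    rw [Function.iterate_succ_apply, h1, Function.iterate_succ_apply, fwdDiff_const]
    have h2 := congrFun (fwdDiff_iter_const_smul (1 : ℕ) (0 : A) (fun _ : ℕ ↦ (0 : A)) k) 0
    rw [zero_smul, zero_smul] at h2
    rw [if_neg (by omega)]
    exact h2

include R in
-- The main part `l t^b` is linear in `l`, so its only nonzero difference at `0` is the first, equal
-- to `t^b`. The rest is a multiple of `t^((p-1)b)`.
theorem exists_beta : ∃ β : TwistedGroupRing S T, ∀ l < p,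
    β • t ^ l = l * stdPow p t s (l + b) := by
  choose r hr using R.exists_stdPow_eq
  obtain ⟨f, hf⟩ := R.exists_smul_pow_eq (z := fun l ↦ (l : T) * t ^ b)
    (w := fun k ↦ if k = 1 then 1 else 0) fun k _ ↦ by
      rw [fwdDiff_iter_natCast_mul]
      split_ifs with h
      · simp [h]
      · simp
  obtain ⟨g, hg⟩ := R.exists_smul_pow_eq_of_dvd fun l ↦ l * t ^ b * r (l + b)
  refine ⟨f + g, fun l hl ↦ ?_⟩
  rw [add_smul, hf l hl, hg l hl, hr]
  ring

/-! ### Coordinates of the powers of `β` -/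

section Powers

variable {β : TwistedGroupRing S T} (hβ : ∀ l < p, β • t ^ l = l * stdPow p t s (l + b))
include hβ

theorem beta_smul_stdPow (hp : 0 < p) (n : ℕ) :
    β • stdPow p t s n = (n % p : ℕ) * stdPow p t s (n + b) := by
  rw [stdPow, smul_algebraMap_mul, hβ _ (Nat.mod_lt _ hp), ← stdPow_mod_add hp n b]
  ring

theorem beta_pow_smul_pow (hp : 0 < p) (i : ℕ) {l : ℕ} (hl : l < p) :
    β ^ i • t ^ l = ((∏ m ∈ Finset.range i, (l + m * b) % p : ℕ) : T) *
      stdPow p t s (l + i * b) := by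
  induction i with
  | zero => simp [stdPow_of_lt hl]
  | succ i ih =>
    rw [pow_succ', mul_smul, ih, smul_natCast_mul, beta_smul_stdPow hβ hp, Finset.prod_range_succ]
    rw [show l + i * b + b = l + (i + 1) * b by ring]
    push_cast
    ring

theorem beta_smul_one (hp : 0 < p) : β • (1 : T) = 0 := by
  have h := hβ 0 hp
  rwa [pow_zero, Nat.cast_zero, zero_mul] at h

omit hβ in
open Polynomial in
theorem fwdDiff_iter_natCast_eval (P : T[X]) (k : ℕ) :
    (fwdDiff 1)^[k] (fun l : ℕ ↦ P.eval (l : T)) 0 = (fwdDiff (1 : T))^[k] P.eval 0 := by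
  rw [fwdDiff_iter_eq_sum_shift, fwdDiff_iter_eq_sum_shift]
  simp

include R in
open Polynomial in
-- The factors `(l + m b) % p` may be replaced by `l + m b`, since `p` is a multiple of
-- `t^((p-1)b)`. The product is then a monic polynomial of degree `i` in `l`.
theorem exists_beta_pow_smul_pow [Nontrivial T] (i : ℕ) :
    ∃ (P : T[X]) (z : ℕ → T), P.Monic ∧ P.natDegree = i ∧
      ∀ l < p, β ^ i • t ^ l = t ^ l * (t ^ (i * b) * (P.eval (l : T) + t ^ ((p - 1) * b) * z l)) := by
  have hmod : ∀ l : ℕ, ∃ c : T, ((∏ m ∈ Finset.range i, (l + m * b) % p : ℕ) : T) =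
      ((∏ m ∈ Finset.range i, (l + m * b) : ℕ) : T) + t ^ ((p - 1) * b) * c := by
    intro l
    have h1 : (∏ m ∈ Finset.range i, (l + m * b) % p) ≡ ∏ m ∈ Finset.range i, (l + m * b) [MOD p] :=
      (Finset.prod_nat_mod _ _ _).symm
    obtain ⟨d, hd⟩ := h1.symm.dvd
    obtain ⟨c, hc⟩ := R.pow_dvd_prime
    refine ⟨c * d, ?_⟩
    have h2 := congrArg (Int.cast : ℤ → T) hd
    rw [Int.cast_sub, Int.cast_mul, Int.cast_natCast, Int.cast_natCast, Int.cast_natCast] at h2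
    rw [← mul_assoc, ← hc, ← h2]
    ring
  choose c hc using hmod
  choose r hr using R.exists_stdPow_eq
  refine ⟨∏ m ∈ Finset.range i, (X + C ((m * b : ℕ) : T)),
    fun l ↦ c l + ((∏ m ∈ Finset.range i, (l + m * b) : ℕ) + t ^ ((p - 1) * b) * c l) *
      r (l + i * b), monic_prod_of_monic _ _ fun m _ ↦ monic_X_add_C _, ?_, fun l hl ↦ ?_⟩
  · rw [natDegree_prod_of_monic _ _ fun m _ ↦ monic_X_add_C _]
    simp only [natDegree_X_add_C, Finset.sum_const, Finset.card_range, smul_eq_mul, mul_one]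
  · rw [beta_pow_smul_pow hβ R.prime.pos i hl, hc, hr, eval_prod]
    push_cast
    simp only [eval_add, eval_X, eval_mul, eval_natCast, map_mul, map_natCast]
    ring

include R in
-- Compare `t^(ib)` with `t^(bk)`. For `k < i` a positive power of `t` is left over. For `k = i` the
-- difference of the monic polynomial is `i!`. For `k > i` that difference vanishes and only the
-- error term survives, still divisible by `t` because `i ≥ 1`.
theorem exists_coord_beta_pow_eq [IsDomain T] {i : ℕ} (hi : 1 ≤ i) {k : ℕ} (hk : k < p) :
    ∃ c, R.coord k (β ^ i) = (if k = i then (i.factorial : T) else 0) + t * c := by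
  obtain ⟨P, z, hP, hPi, hz⟩ := exists_beta_pow_smul_pow R hβ i
  have hb := R.one_le
  have hdiff : (fwdDiff 1)^[k]
      (fun l : ℕ ↦ t ^ (i * b) * (P.eval (l : T) + t ^ ((p - 1) * b) * z l)) 0 =
      t ^ (i * b) * ((fwdDiff (1 : T))^[k] P.eval 0 + t ^ ((p - 1) * b) * (fwdDiff 1)^[k] z 0) := by
    have h1 := fwdDiff_iter_const_smul (1 : ℕ) (t ^ (i * b))
      ((fun l : ℕ ↦ P.eval (l : T)) + t ^ ((p - 1) * b) • z) k
    refine (congrFun h1 0).trans ?_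
    rw [← fwdDiff_iter_natCast_eval, fwdDiff_iter_add, fwdDiff_iter_const_smul]
    rfl
  have hcoord : ∀ w, t ^ (i * b) * ((fwdDiff (1 : T))^[k] P.eval 0 +
      t ^ ((p - 1) * b) * (fwdDiff 1)^[k] z 0) = t ^ (b * k) * w → R.coord k (β ^ i) = w :=
    fun w hw ↦ R.coord_eq_of_smul_pow (fun l hl ↦ hz l (hl.trans_lt hk)) (hdiff.trans hw)
  rcases lt_trichotomy k i with h | rfl | h
  · refine ⟨t ^ ((i - k) * b - 1) * ((fwdDiff (1 : T))^[k] P.eval 0 +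
      t ^ ((p - 1) * b) * (fwdDiff 1)^[k] z 0), hcoord _ ?_⟩
    rw [if_neg h.ne, zero_add, ← mul_assoc t, ← mul_assoc, ← pow_succ', ← pow_add]
    congr 2
    obtain ⟨d, rfl⟩ := Nat.exists_eq_add_of_lt h
    have h1 : 1 ≤ (k + d + 1 - k) * b := Nat.mul_pos (by omega) hb
    rw [Nat.sub_add_cancel h1, mul_comm b, ← add_mul]
    congr 1
    omega
  · refine ⟨t ^ ((p - 1) * b - 1) * (fwdDiff 1)^[k] z 0, hcoord _ ?_⟩
    have h2 := congrFun (Polynomial.fwdDiff_iter_degree_eq_factorial P) 0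
    rw [hPi, hP.leadingCoeff, one_smul] at h2
    have h3 : 1 ≤ (p - 1) * b := Nat.mul_pos (by omega) hb
    rw [if_pos rfl, ← mul_assoc t, ← pow_succ', Nat.sub_add_cancel h3, h2, mul_comm b]
    rfl
  · refine ⟨t ^ ((p - 1 - k) * b + i * b - 1) * (fwdDiff 1)^[k] z 0, hcoord _ ?_⟩
    have h2 := congrFun (Polynomial.fwdDiff_iter_eq_zero_of_degree_lt (P := P) (hPi ▸ h)) 0
    have h3 : 1 ≤ (p - 1 - k) * b + i * b := Nat.le_add_left_of_le (Nat.mul_pos hi hb)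
    rw [if_neg h.ne', h2, Pi.zero_apply, zero_add, zero_add, ← mul_assoc t, ← pow_succ',
      Nat.sub_add_cancel h3, ← mul_assoc, ← mul_assoc, ← pow_add, ← pow_add]
    congr 2
    rw [mul_comm b, ← add_mul, ← add_mul, ← add_mul]
    congr 1
    omega

end Powers

end

end RamificationData

/-! ### Exactness -/

namespace RamificationData

open SkewMonoidAlgebra

variable {S : Type u} {T : Type v} [CommRing S] [CommRing T] [Algebra S T]
  {p b : ℕ} {t : T} {s : S} (R : RamificationData S T p b t s)

include R in
theorem associated_algebraMap_pow [IsLocalRing T] : Associated (algebraMap S T s) (t ^ p) := by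
  obtain ⟨r, hr⟩ := R.algebraMap_eq
  have h1 : t ^ ((p - 1) * b) * r ∈ IsLocalRing.maximalIdeal T := by
    have h2 : (p - 1) * b ≠ 0 :=
      Nat.mul_ne_zero (by have := R.prime.two_le; omega) (by have := R.one_le; omega)
    exact Ideal.mul_mem_right _ _ (Ideal.pow_mem_of_mem _
      ((IsLocalRing.mem_maximalIdeal _).2 R.irreducible.not_isUnit) _ (Nat.pos_of_ne_zero h2))
  have h3 : IsUnit (1 + t ^ ((p - 1) * b) * r) := by
    by_contra h
    have h4 := Ideal.sub_mem _ ((IsLocalRing.mem_maximalIdeal _).2 h) h1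
    rw [add_sub_cancel_right] at h4
    exact h4 isUnit_one
  rw [hr]
  exact associated_mul_unit_left _ _ h3

include R in
theorem algebraMap_pow_ne_zero [IsDomain T] [IsLocalRing T] (n : ℕ) :
    algebraMap S T (s ^ n) ≠ 0 := by
  rw [map_pow]
  exact pow_ne_zero _
    (R.associated_algebraMap_pow.ne_zero_iff.2 (pow_ne_zero _ R.irreducible.ne_zero))

theorem add_sub_mod_add_mod (hp : 0 < p) {m : ℕ} (hm : m < p) (b : ℕ) :
    ((m + (p - b % p)) % p + b) % p = m := by
  rw [Nat.mod_add_mod, Nat.add_mod, ← Nat.add_mod_mod, Nat.mod_add_mod]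
  have h := Nat.mod_lt b hp
  rw [Nat.add_assoc, Nat.mod_mod, Nat.sub_add_cancel h.le, Nat.add_mod_right, Nat.mod_eq_of_lt hm]

theorem add_sub_mod_ne_zero (hp : 0 < p) {m : ℕ} (hm : m < p) {b : ℕ} (hmb : m ≠ b % p) :
    (m + (p - b % p)) % p ≠ 0 := by
  intro h
  have h1 := add_sub_mod_add_mod hp hm b
  rw [h, zero_add] at h1
  exact hmb h1.symm

theorem not_dvd_of_lt {p l : ℕ} (h0 : l ≠ 0) (hl : l < p) : ¬ p ∣ l :=
  Nat.not_dvd_of_pos_of_lt (Nat.pos_of_ne_zero h0) hl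

theorem not_dvd_choose (hp : p.Prime) {k : ℕ} (hk : k ≤ p - 1) : ¬ p ∣ (p - 1).choose k := by
  intro h
  have h1 : p ∣ (p - 1).factorial := by
    rw [← Nat.choose_mul_factorial_mul_factorial hk, mul_assoc]
    exact h.mul_right _
  have h2 := (hp.dvd_factorial).1 h1
  have := hp.pos
  omega

theorem coord_zero (f : TwistedGroupRing S T) : R.coord 0 f = f • (1 : T) := by
  have h := R.fwdDiff_iter_mult f 0
  rw [mul_zero, pow_zero, one_mul] at h
  have h1 := R.smul_pow f 0
  rw [pow_zero, one_mul] at h1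
  rw [← h, h1]
  rfl

section

variable [IsDomain T] [IsLocalRing T] {α β : TwistedGroupRing S T}
  (hα : ∀ l < p, α • t ^ l = if l = b % p then algebraMap S T (s ^ (b - b / p)) else 0)
  (hβ : ∀ l < p, β • t ^ l = l * stdPow p t s (l + b))

include R hα hβ in
omit [IsLocalRing T] in
theorem alpha_mul_beta : α * β = 0 := by
  refine R.ext_smul_pow fun l hl ↦ ?_
  rw [mul_smul, hβ l hl, smul_natCast_mul, stdPow, smul_algebraMap_mul,
    hα _ (Nat.mod_lt _ R.prime.pos), zero_smul]
  by_cases h : l = 0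
  · simp [h]
  · rw [if_neg, mul_zero, mul_zero]
    intro h1
    have h2 : (l + b) ≡ 0 + b [MOD p] := by simpa [Nat.ModEq] using h1
    have h3 := Nat.ModEq.add_right_cancel' b h2
    rw [Nat.ModEq, Nat.zero_mod, Nat.mod_eq_of_lt hl] at h3
    exact h h3

include R hα hβ in
omit [IsLocalRing T] in
theorem beta_mul_alpha : β * α = 0 := by
  refine R.ext_smul_pow fun l hl ↦ ?_
  rw [mul_smul, hα l hl, zero_smul]
  split_ifs with h
  · rw [← mul_one (algebraMap S T _), smul_algebraMap_mul, beta_smul_one hβ R.prime.pos, mul_zero]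
  · exact smul_zero _

include R hβ in
-- Nakayama over `T`: modulo `t`, the powers `β^i` with `1 ≤ i < p` span the elements whose
-- coordinate `0` vanishes, since `i!` is a unit.
theorem exists_eq_mul_beta [IsNoetherianRing T] {f : TwistedGroupRing S T}
    (hf : f • (1 : T) = 0) : ∃ g, f = g * β := by
  have := R.finite_algEquiv
  have hfin : Module.Finite T (TwistedGroupRing S T) := Module.Finite.of_basis basisSingleOne
  let N : Submodule T (TwistedGroupRing S T) :=
    { carrier := {x | ∃ g, x = g * β}
      add_mem' := by
        rintro _ _ ⟨g, rfl⟩ ⟨h, rfl⟩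
        exact ⟨g + h, (add_mul _ _ _).symm⟩
      zero_mem' := ⟨0, (zero_mul _).symm⟩
      smul_mem' := by
        rintro c _ ⟨g, rfl⟩
        exact ⟨single 1 c * g, by rw [← single_one_mul_eq_smul, mul_assoc]⟩ }
  have hle : LinearMap.ker (R.coord 0) ≤ N := by
    refine Submodule.le_of_le_smul_of_le_jacobson_bot (I := IsLocalRing.maximalIdeal T)
      (IsNoetherian.noetherian _) (IsLocalRing.maximalIdeal_le_jacobson _) fun f hf ↦ ?_
    have hfac : ∀ i : ℕ, ∃ v : T, i < p → (i.factorial : T) * v = 1 := by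
      intro i
      by_cases hi : i < p
      · have h := R.isUnit_natCast_top (l := i.factorial)
          fun h ↦ (R.prime.dvd_factorial.1 h).not_gt hi
        obtain ⟨v, hv⟩ := h.exists_right_inv
        exact ⟨v, fun _ ↦ hv⟩
      · exact ⟨0, fun h ↦ absurd h hi⟩
    choose v hv using hfac
    set g : TwistedGroupRing S T :=
      ∑ i ∈ Finset.Ico 1 p, (v i * R.coord i f) • β ^ i with hg
    have hgN : g ∈ N := by
      refine Submodule.sum_mem _ fun i hi ↦ Submodule.smul_mem _ _ ⟨β ^ (i - 1), ?_⟩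
      rw [← pow_succ, Nat.sub_add_cancel (Finset.mem_Ico.1 hi).1]
    have hg0 : R.coord 0 g = 0 := by
      rw [hg, _root_.map_sum]
      refine Finset.sum_eq_zero fun i hi ↦ ?_
      have h : β ^ i • (1 : T) = 0 := by
        rw [← Nat.sub_add_cancel (Finset.mem_Ico.1 hi).1, pow_succ, mul_smul,
          beta_smul_one hβ R.prime.pos, smul_zero]
      rw [map_smul, coord_zero, h, smul_zero]
    -- Nakayama needs `f - g = t • h` with `h` again in the kernel, hence the requirement `d = 0` at
    -- `k = 0`.
    have hdiv : ∀ k : ℕ, ∃ d : T, (k < p → R.coord k (f - g) = t * d) ∧ (k = 0 → d = 0) := by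
      intro k
      by_cases hk0 : k = 0
      · refine ⟨0, fun _ ↦ ?_, fun _ ↦ rfl⟩
        rw [hk0, map_sub, hg0, LinearMap.mem_ker.1 hf, sub_zero, mul_zero]
      by_cases hk : k < p
      · suffices h : t ∣ R.coord k (f - g) by
          obtain ⟨d, hd⟩ := h
          exact ⟨d, fun _ ↦ hd, fun h ↦ absurd h hk0⟩
        have hkmem : k ∈ Finset.Ico 1 p := Finset.mem_Ico.2 ⟨by omega, hk⟩
        rw [map_sub, hg, _root_.map_sum, ← Finset.add_sum_erase _ _ hkmem, ← sub_sub]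
        refine dvd_sub ?_ (Finset.dvd_sum fun i hi ↦ ?_)
        · obtain ⟨c, hc⟩ := exists_coord_beta_pow_eq R hβ (Finset.mem_Ico.1 hkmem).1 hk
          refine ⟨-(v k * R.coord k f * c), ?_⟩
          rw [map_smul, hc, if_pos rfl, smul_eq_mul]
          linear_combination -R.coord k f * hv k hk
        · obtain ⟨c, hc⟩ := exists_coord_beta_pow_eq R hβ
            (Finset.mem_Ico.1 (Finset.mem_of_mem_erase hi)).1 hk
          rw [map_smul, hc, if_neg (Finset.ne_of_mem_erase hi).symm, zero_add]
          exact (dvd_mul_right _ _).mul_left _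
      · exact ⟨0, fun h ↦ absurd h hk, fun _ ↦ rfl⟩
    choose d hd hd0 using hdiv
    obtain ⟨h, hh⟩ := R.exists_coord_eq d
    have hfg : f - g = t • h := by
      refine R.ext_coord fun k hk ↦ ?_
      rw [hd k hk, map_smul, hh k hk, smul_eq_mul]
    rw [← add_sub_cancel g f, hfg]
    refine Submodule.add_mem_sup hgN (Submodule.smul_mem_smul
      ((IsLocalRing.mem_maximalIdeal _).2 R.irreducible.not_isUnit) ?_)
    rw [LinearMap.mem_ker, hh 0 R.prime.pos, hd0 0 rfl]
  exact hle (by rw [LinearMap.mem_ker, coord_zero, hf])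

include R hα in
theorem smul_one_eq_zero_of_mul_alpha {f : TwistedGroupRing S T} (hf : f * α = 0) :
    f • (1 : T) = 0 := by
  have h := congrArg (· • t ^ (b % p)) hf
  rw [mul_smul, hα _ (Nat.mod_lt _ R.prime.pos), if_pos rfl, ← mul_one (algebraMap S T _),
    smul_algebraMap_mul, zero_smul] at h
  exact (mul_eq_zero.1 h).resolve_left (R.algebraMap_pow_ne_zero _)

include R hβ in
-- Such a `t^m` is, up to a nonzero factor, `β • t^l` with `l ≠ 0` and `l + b ≡ m` modulo `p`.
theorem smul_pow_eq_zero_of_mul_beta {f : TwistedGroupRing S T} (hf : f * β = 0) {m : ℕ}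
    (hm : m < p) (hmb : m ≠ b % p) : f • t ^ m = 0 := by
  have hp := R.prime.pos
  set l := (m + (p - b % p)) % p with hl
  have hlp : l < p := Nat.mod_lt _ hp
  have hl0 : l ≠ 0 := add_sub_mod_ne_zero hp hm hmb
  have h := congrArg (· • t ^ l) hf
  rw [mul_smul, hβ l hlp, smul_natCast_mul, stdPow, smul_algebraMap_mul, zero_smul,
    add_sub_mod_add_mod hp hm] at h
  have h1 := (R.isUnit_natCast_top (not_dvd_of_lt hl0 hlp)).ne_zero
  exact (mul_eq_zero.1 ((mul_eq_zero.1 h).resolve_left h1)).resolve_left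
    (R.algebraMap_pow_ne_zero _)

include R hα hβ in
-- The sequence of `f` is supported at `b % p`, so its `(p-1)`-st difference is its value `y` there
-- times a binomial coefficient prime to `p`. Thus `t^((p-1)b)` divides `y`, which is the
-- divisibility defining `α`.
theorem exists_eq_mul_alpha {f : TwistedGroupRing S T} (hf : f * β = 0) : ∃ g, f = g * α := by
  have hp := R.prime.pos
  have hb := Nat.mod_lt b hp
  have hz := fun {m : ℕ} ↦ R.smul_pow_eq_zero_of_mul_beta hβ hf (m := m)
  set y := R.mult (b % p) f with hy
  have h1 := R.fwdDiff_iter_of_smul_pow (f := f) (z := fun l ↦ if l = b % p then y else 0)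
    (k := p - 1) fun l hl ↦ by
      split_ifs with h
      · rw [h, R.smul_pow]
      · rw [hz (by omega) h, mul_zero]
  have h2 : t ^ (b * (p - 1)) ∣ y := by
    rw [fwdDiff_iter_eq_sum_shift, Finset.sum_eq_single (b % p)] at h1
    · have h3 := R.isUnit_natCast_top (not_dvd_choose R.prime (Nat.le_pred_of_lt hb))
      have h4 : IsUnit (((-1) ^ (p - 1 - b % p) * ((p - 1).choose (b % p) : ℤ) : ℤ) : T) := by
        push_cast
        exact (isUnit_one.neg.pow _).mul h3
      rw [zero_add, smul_eq_mul, mul_one, if_pos rfl, zsmul_eq_mul] at h1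
      exact h4.dvd_mul_left.1 ⟨_, h1⟩
    · intro m _ hm
      rw [zero_add, smul_eq_mul, mul_one, if_neg hm, smul_zero]
    · intro h
      exact absurd (Finset.mem_range.2 (by omega)) h
  obtain ⟨x, hx⟩ : algebraMap S T (s ^ (b - b / p)) ∣ f • t ^ (b % p) := by
    rw [map_pow, (R.associated_algebraMap_pow.pow_pow).dvd_iff_dvd_left, ← pow_mul,
      mul_sub_div hp, R.smul_pow, add_comm, pow_add, mul_comm _ b]
    exact mul_dvd_mul_left _ h2
  refine ⟨single 1 x, R.ext_smul_pow fun l hl ↦ ?_⟩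
  rw [single_one_mul_smul, hα l hl]
  split_ifs with h
  · rw [h, hx, mul_comm]
  · rw [hz hl h, mul_zero]

end

end RamificationData

/-! ### The periodic resolution -/

namespace TwistedGroupRing

variable {S : Type u} {T : Type v} [CommRing S] [CommRing T] [Algebra S T]

/-- The maps are right multiplications, so diagrammatic composition keeps the order of the factors.
-/
theorem endOf_comp_endOf (a c : TwistedGroupRing S T) : endOf a ≫ endOf c = endOf (a * c) := by
  ext : 1
  refine LinearMap.ext_ring ?_
  change (1 * a) * c = 1 * (a * c)
  rw [one_mul, one_mul]

theorem endOf_zero : endOf (0 : TwistedGroupRing S T) = 0 := by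
  ext : 1
  refine LinearMap.ext_ring ?_
  exact one_smul _ _

/-- The linear map from the twisted group ring to `T` with `1 ↦ x`. -/
noncomputable def homOf (S : Type u) {T : Type v} [CommRing S] [CommRing T] [Algebra S T] (x : T) :
    freeMod S T ⟶ natMod S T :=
  ModuleCat.ofHom (LinearMap.toSpanSingleton (TwistedGroupRing S T) T x)

theorem hom_ext_one {f g : freeMod S T ⟶ natMod S T}
    (h : f.hom (1 : TwistedGroupRing S T) = g.hom (1 : TwistedGroupRing S T)) : f = g := by
  ext : 1
  exact LinearMap.ext_ring h

theorem homOf_one_eq (f : freeMod S T ⟶ natMod S T) :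
    homOf S (f.hom (1 : TwistedGroupRing S T)) = f :=
  hom_ext_one (one_smul _ _)

theorem homOf_injective : Function.Injective (homOf S : T → _) := by
  intro x y h
  have h1 := congrArg (fun f ↦ f.hom (1 : TwistedGroupRing S T)) h
  exact (one_smul _ x).symm.trans (h1.trans (one_smul _ y))

theorem homOf_zero : homOf S (0 : T) = 0 := hom_ext_one (one_smul _ _)

theorem homOf_add (x y : T) : homOf S (x + y) = homOf S x + homOf S y :=
  hom_ext_one (by
    change (1 : TwistedGroupRing S T) • (x + y) =
      (1 : TwistedGroupRing S T) • x + (1 : TwistedGroupRing S T) • y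
    simp)

theorem algebraMap_smul_eq (a : S) (x : T) :
    algebraMap S (TwistedGroupRing S T) a • x = a • x := by
  change wedderburn S T (algebraMap S (TwistedGroupRing S T) a) x = a • x
  rw [AlgHom.commutes]
  rfl

theorem homOf_smul (a : S) (x : T) : homOf S (a • x) = a • homOf S x :=
  hom_ext_one (by
    change (1 : TwistedGroupRing S T) • (a • x) =
      algebraMap S (TwistedGroupRing S T) a • ((1 : TwistedGroupRing S T) • x)
    rw [one_smul, one_smul, algebraMap_smul_eq])

theorem endOf_comp_homOf (a : TwistedGroupRing S T) (x : T) :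
    endOf a ≫ homOf S x = homOf S (a • x) :=
  hom_ext_one (by
    change ((1 : TwistedGroupRing S T) * a) • x = (1 : TwistedGroupRing S T) • (a • x)
    rw [one_mul, one_smul])

section Resolution

variable (α β : TwistedGroupRing S T) (hαβ : α * β = 0) (hβα : β * α = 0)
  (hβ : β • (1 : T) = 0)

/-- The complex `⋯ ⟶ Ξ ⟶ Ξ ⟶ Ξ` with maps `1 ↦ α` and `1 ↦ β`. -/
noncomputable def periodicComplex : ChainComplex (ModuleCat.{v} (TwistedGroupRing S T)) ℕ :=
  HomologicalComplex.alternatingConst (freeMod S T) (φ := endOf α) (ψ := endOf β)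
    (by rw [endOf_comp_endOf, hαβ, endOf_zero]) (by rw [endOf_comp_endOf, hβα, endOf_zero])
    fun _ _ ↦ ComplexShape.down_nat_odd_add

theorem periodicComplex_d_even {n : ℕ} (hn : Even n) :
    (periodicComplex α β hαβ hβα).d (n + 1) n = endOf β := by
  simp [periodicComplex, HomologicalComplex.alternatingConst, Nat.even_add_one, hn]

theorem periodicComplex_d_odd {n : ℕ} (hn : Odd n) :
    (periodicComplex α β hαβ hβα).d (n + 1) n = endOf α := by
  simp [periodicComplex, HomologicalComplex.alternatingConst, Nat.even_add_one,
    Nat.not_even_iff_odd.2 hn]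

include hβ in
theorem periodicComplex_d_comp_homOf (i : ℕ) (hi : (ComplexShape.down ℕ).Rel i 0) :
    (periodicComplex α β hαβ hβα).d i 0 ≫ homOf S 1 = 0 := by
  obtain rfl : 0 + 1 = i := hi
  rw [periodicComplex_d_even α β hαβ hβα Even.zero]
  exact (endOf_comp_homOf β 1).trans (by rw [hβ, homOf_zero]; rfl)

/-- The augmentation `1 ↦ 1` of `periodicComplex`. -/
noncomputable def periodicComplexπ : periodicComplex α β hαβ hβα ⟶
    (ChainComplex.single₀ (ModuleCat.{v} (TwistedGroupRing S T))).obj (natMod S T) :=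
  HomologicalComplex.mkHomToSingle (homOf S 1) (periodicComplex_d_comp_homOf α β hαβ hβα hβ)

theorem periodicComplexπ_f_zero : (periodicComplexπ α β hαβ hβα hβ).f 0 = homOf S 1 ≫
    (HomologicalComplex.singleObjXSelf (ComplexShape.down ℕ) 0 (natMod S T)).inv :=
  HomologicalComplex.mkHomToSingle_f _ (periodicComplex_d_comp_homOf α β hαβ hβα hβ)

variable (h₀ : ∀ f : TwistedGroupRing S T, f • (1 : T) = 0 → ∃ g, f = g * β)
  (h₁ : ∀ f : TwistedGroupRing S T, f * β = 0 → ∃ g, f = g * α)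
  (h₂ : ∀ f : TwistedGroupRing S T, f * α = 0 → ∃ g, f = g * β)
  (hsurj : ∀ x : T, ∃ f : TwistedGroupRing S T, f • (1 : T) = x)

include h₀ h₁ h₂ hsurj in
theorem quasiIso_periodicComplexπ : QuasiIso (periodicComplexπ α β hαβ hβα hβ) where
  quasiIsoAt m := by
    cases m with
    | zero =>
      simp only [periodicComplexπ]
      rw [ChainComplex.quasiIsoAt₀_iff, ShortComplex.quasiIso_iff_of_zeros' _ rfl rfl rfl]
      constructor
      · rw [ShortComplex.moduleCat_exact_iff]
        intro f hf
        obtain ⟨g, hg⟩ := h₀ f (by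
          refine Eq.trans ?_ hf
          simp
          rfl)
        refine ⟨g, ?_⟩
        refine (congrArg (fun d ↦ d.hom g) (periodicComplex_d_even α β hαβ hβα Even.zero)).trans hg.symm
      · rw [ModuleCat.epi_iff_surjective]
        intro x
        obtain ⟨f, hf⟩ := hsurj x
        refine ⟨f, ?_⟩
        refine Eq.trans ?_ hf
        simp
        rfl
    | succ m =>
      rw [quasiIsoAt_iff_exactAt' (hL := ChainComplex.exactAt_succ_single_obj ..),
          HomologicalComplex.exactAt_iff' _ (m + 2) (m + 1) m (by simp) (by simp)]
      rw [ShortComplex.moduleCat_exact_iff]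
      intro (f : TwistedGroupRing S T) hf
      rcases Nat.even_or_odd m with hm | hm
      · have hf' : f * β = 0 :=
          (congrArg (fun d ↦ d.hom f) (periodicComplex_d_even α β hαβ hβα hm)).symm.trans hf
        obtain ⟨g, hg⟩ := h₁ f hf'
        exact ⟨g, (congrArg (fun d ↦ d.hom g)
          (periodicComplex_d_odd α β hαβ hβα hm.add_one)).trans hg.symm⟩
      · have hf' : f * α = 0 :=
          (congrArg (fun d ↦ d.hom f) (periodicComplex_d_odd α β hαβ hβα hm)).symm.trans hf
        obtain ⟨g, hg⟩ := h₂ f hf'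
        exact ⟨g, (congrArg (fun d ↦ d.hom g)
          (periodicComplex_d_even α β hαβ hβα hm.add_one)).trans hg.symm⟩

/-- The periodic resolution by `periodicComplex`. -/
noncomputable def periodicResolution : PeriodicResolution α β where
  res :=
    { complex := periodicComplex α β hαβ hβα
      projective := fun _ ↦ inferInstanceAs (Projective (freeMod S T))
      π := periodicComplexπ α β hαβ hβα hβ
      quasiIso := quasiIso_periodicComplexπ α β hαβ hβα hβ h₀ h₁ h₂ hsurj }
  term := fun _ ↦ Iso.refl _
  d_even := fun n hn ↦ by
    rw [Iso.refl_hom, Iso.refl_hom, periodicComplex_d_even α β hαβ hβα hn]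
    rfl
  d_odd := fun n hn ↦ by
    rw [Iso.refl_hom, Iso.refl_hom, periodicComplex_d_odd α β hαβ hβα hn]
    rfl
  aug :=
    (congrArg (· ≫ (HomologicalComplex.singleObjXSelf (ComplexShape.down ℕ) 0 (natMod S T)).hom)
      (periodicComplexπ_f_zero α β hαβ hβα hβ)).trans <|
    (Category.assoc _ _ _).trans <|
    (congrArg (homOf S 1 ≫ ·) (Iso.inv_hom_id _)).trans <|
    (Category.comp_id _).trans (Category.id_comp _).symm

end Resolution

/-! ### `Ext` as cohomology of `Hom_Ξ(P, T)` -/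

namespace PeriodicResolution

variable {α β : TwistedGroupRing S T} (P : PeriodicResolution α β)

/-- Identifying a map with its value at `1`, the differential leaving an even degree is the action
of `β` on `T`. -/
theorem d_comp_term_homOf_even {n : ℕ} (hn : Even n) (x : T) :
    P.res.complex.d (n + 1) n ≫ (P.term n).hom ≫ homOf S x =
      (P.term (n + 1)).hom ≫ homOf S (β • x) := by
  rw [← Category.assoc, P.d_even n hn, Category.assoc, endOf_comp_homOf]

theorem d_comp_term_homOf_odd {n : ℕ} (hn : Odd n) (x : T) :
    P.res.complex.d (n + 1) n ≫ (P.term n).hom ≫ homOf S x =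
      (P.term (n + 1)).hom ≫ homOf S (α • x) := by
  rw [← Category.assoc, P.d_odd n hn, Category.assoc, endOf_comp_homOf]

theorem term_hom_comp_homOf_eq_zero_iff (n : ℕ) (x : T) :
    (P.term n).hom ≫ homOf S x = 0 ↔ x = 0 := by
  rw [Preadditive.IsIso.comp_left_eq_zero]
  exact ⟨fun h ↦ homOf_injective (h.trans homOf_zero.symm), fun h ↦ h ▸ homOf_zero⟩

theorem isCocycle_even_iff {n : ℕ} (hn : Even n) (x : T) :
    P.IsCocycle n (homOf S x) ↔ β • x = 0 := by
  rw [IsCocycle, d_comp_term_homOf_even P hn, term_hom_comp_homOf_eq_zero_iff]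

theorem isCocycle_odd_iff {n : ℕ} (hn : Odd n) (x : T) :
    P.IsCocycle n (homOf S x) ↔ α • x = 0 := by
  rw [IsCocycle, d_comp_term_homOf_odd P hn, term_hom_comp_homOf_eq_zero_iff]

theorem exists_eq_term_hom_comp_homOf {n : ℕ} (f : P.res.complex.X n ⟶ natMod S T) :
    ∃ x : T, (P.term n).hom ≫ homOf S x = f :=
  ⟨((P.term n).inv ≫ f).hom (1 : TwistedGroupRing S T), by
    rw [homOf_one_eq, Iso.hom_inv_id_assoc]⟩

theorem extClass_odd_eq_zero_iff {n : ℕ} (hn : Even n) {x : T}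
    (hx : P.IsCocycle (n + 1) (homOf S x)) :
    P.extClass (n + 1) (homOf S x) hx = 0 ↔ ∃ y : T, β • y = x := by
  rw [extClass, P.res.extMk_eq_zero_iff _ _ _ _ n rfl]
  constructor
  · rintro ⟨g, hg⟩
    obtain ⟨y, rfl⟩ := P.exists_eq_term_hom_comp_homOf g
    rw [P.d_comp_term_homOf_even hn, Iso.cancel_iso_hom_left] at hg
    exact ⟨y, homOf_injective hg⟩
  · rintro ⟨y, rfl⟩
    exact ⟨(P.term n).hom ≫ homOf S y, P.d_comp_term_homOf_even hn y⟩

theorem extClass_even_eq_zero_iff {n : ℕ} (hn : Odd n) {x : T}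
    (hx : P.IsCocycle (n + 1) (homOf S x)) :
    P.extClass (n + 1) (homOf S x) hx = 0 ↔ ∃ y : T, α • y = x := by
  rw [extClass, P.res.extMk_eq_zero_iff _ _ _ _ n rfl]
  constructor
  · rintro ⟨g, hg⟩
    obtain ⟨y, rfl⟩ := P.exists_eq_term_hom_comp_homOf g
    rw [P.d_comp_term_homOf_odd hn, Iso.cancel_iso_hom_left] at hg
    exact ⟨y, homOf_injective hg⟩
  · rintro ⟨y, rfl⟩
    exact ⟨(P.term n).hom ≫ homOf S y, P.d_comp_term_homOf_odd hn y⟩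

theorem extClass_zero_eq_zero_iff {x : T} (hx : P.IsCocycle 0 (homOf S x)) :
    P.extClass 0 (homOf S x) hx = 0 ↔ x = 0 := by
  refine Iff.trans ?_ (P.term_hom_comp_homOf_eq_zero_iff 0 x)
  constructor
  · intro h
    rw [extClass, ← P.res.extEquivCohomologyClass.apply_eq_iff_eq,
      ProjectiveResolution.extEquivCohomologyClass_extMk,
      ProjectiveResolution.extEquivCohomologyClass_zero,
      CochainComplex.HomComplex.CohomologyClass.mk_eq_zero_iff,
      CochainComplex.HomComplex.Cocycle.toSingleMk_mem_coboundaries_iff _ _ _ _ _ 1 (by simp)] at h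
    obtain ⟨g, hg⟩ := h
    -- The resolution vanishes in cohomological degree `1`, so degree `0` has no nonzero
    -- coboundaries.
    have h1 : CategoryTheory.Limits.IsZero (P.res.cochainComplex.X 1) :=
      CochainComplex.isZero_of_isStrictlyLE _ 0 1 (by simp)
    rw [h1.eq_of_src g 0, Limits.comp_zero, eq_comm, Preadditive.IsIso.comp_left_eq_zero] at hg
    exact hg
  · intro h
    simp only [extClass, h, ProjectiveResolution.extMk_zero]

theorem extClass_add {n : ℕ} {x y : T} (hx : P.IsCocycle n (homOf S x))
    (hy : P.IsCocycle n (homOf S y)) (hxy : P.IsCocycle n (homOf S (x + y))) :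
    P.extClass n (homOf S (x + y)) hxy =
      P.extClass n (homOf S x) hx + P.extClass n (homOf S y) hy := by
  simp only [extClass, ProjectiveResolution.add_extMk, homOf_add, Preadditive.comp_add]

theorem extClass_smul {n : ℕ} (a : S) {x : T} (hx : P.IsCocycle n (homOf S x))
    (hax : P.IsCocycle n (homOf S (a • x))) :
    P.extClass n (homOf S (a • x)) hax = a • P.extClass n (homOf S x) hx := by
  rw [Ext.smul_eq_comp_mk₀]
  simp only [extClass, ProjectiveResolution.extMk_comp_mk₀, homOf_smul, Linear.comp_smul,
    Category.comp_id]

/-- An `Ext`-group of `T` with itself is computed by the cocycles modulo the coboundaries. -/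
theorem exists_linearEquiv_ext (n : ℕ) {M N : Type*} [AddCommGroup M] [Module S M]
    [AddCommGroup N] [Module S N] (π : N →ₗ[S] M) (hπ : Function.Surjective π) (F : N →ₗ[S] T)
    (hF : ∀ x, P.IsCocycle n (homOf S x) ↔ ∃ y, F y = x)
    (hker : ∀ y (hy : P.IsCocycle n (homOf S (F y))),
      P.extClass n (homOf S (F y)) hy = 0 ↔ π y = 0) :
    ∃ φ : M ≃ₗ[S] Ext (natMod S T) (natMod S T) n,
      ∀ y x (hx : P.IsCocycle n (homOf S x)), F y = x →
        φ (π y) = P.extClass n (homOf S x) hx := by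
  have hc : ∀ y, P.IsCocycle n (homOf S (F y)) := fun y ↦ (hF _).2 ⟨y, rfl⟩
  let q : N →ₗ[S] Ext (natMod S T) (natMod S T) n :=
    { toFun := fun y ↦ P.extClass n (homOf S (F y)) (hc y)
      map_add' := fun y z ↦ by
        simp only [map_add]
        exact P.extClass_add _ _ _
      map_smul' := fun a y ↦ by
        simp only [map_smul, RingHom.id_apply]
        exact P.extClass_smul _ _ _ }
  have hq : Function.Surjective q := by
    intro e
    obtain ⟨f, hf, rfl⟩ := P.res.extMk_surjective e (n + 1) rfl
    obtain ⟨x, rfl⟩ := P.exists_eq_term_hom_comp_homOf f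
    obtain ⟨y, rfl⟩ := (hF x).1 hf
    exact ⟨y, rfl⟩
  have hqπ : LinearMap.ker π = LinearMap.ker q :=
    Submodule.ext fun y ↦ (hker y (hc y)).symm
  refine ⟨(π.quotKerEquivOfSurjective hπ).symm.trans
    ((Submodule.quotEquivOfEq _ _ hqπ).trans (q.quotKerEquivOfSurjective hq)), ?_⟩
  rintro y _ hy rfl
  have h1 : (π.quotKerEquivOfSurjective hπ).symm (π y) = Submodule.Quotient.mk y := by
    rw [LinearEquiv.symm_apply_eq]
    rfl
  rw [LinearEquiv.trans_apply, h1]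
  rfl

end PeriodicResolution

end TwistedGroupRing

/-! ### Kernels and images of `α` and `β` on `T` -/

namespace RamificationData

open TwistedGroupRing

variable {S : Type u} {T : Type v} [CommRing S] [CommRing T] [Algebra S T]
  {p b : ℕ} {t : T} {s : S} (R : RamificationData S T p b t s)

theorem smul_eq_sum (f : TwistedGroupRing S T) (x : T) :
    f • x = ∑ i, R.basis.repr x i • (f • t ^ (i : ℕ)) := by
  have h : wedderburn S T f x = ∑ i, R.basis.repr x i • wedderburn S T f (t ^ (i : ℕ)) := by
    conv_lhs => rw [← R.basis.sum_repr x]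
    simp only [map_sum, map_smul, R.basis_apply]
  exact h

theorem repr_stdPow (n : ℕ) (m : Fin p) :
    R.basis.repr (stdPow p t s n) m = if n % p = m then s ^ (n / p) else 0 := by
  have h : stdPow p t s n = s ^ (n / p) • R.basis ⟨n % p, Nat.mod_lt _ R.prime.pos⟩ := by
    rw [R.basis_apply, Algebra.smul_def, stdPow]
  rw [h, map_smul, Finsupp.smul_apply, R.basis.repr_self, Finsupp.single_apply, smul_eq_mul,
    mul_ite, mul_one, mul_zero]
  simp only [Fin.ext_iff]

theorem repr_algebraMap (a : S) (m : Fin p) :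
    R.basis.repr (algebraMap S T a) m = if (m : ℕ) = 0 then a else 0 := by
  have h : algebraMap S T a = a • R.basis ⟨0, R.prime.pos⟩ := by
    rw [R.basis_apply, Algebra.smul_def, pow_zero, mul_one]
  rw [h, map_smul, Finsupp.smul_apply, R.basis.repr_self, Finsupp.single_apply, smul_eq_mul,
    mul_ite, mul_one, mul_zero]
  simp only [Fin.ext_iff, eq_comm]

include R in
theorem algebraMap_injective : Function.Injective (algebraMap S T) := by
  intro a c h
  have h1 := congrArg (fun x ↦ R.basis.repr x ⟨0, R.prime.pos⟩) h
  simpa [repr_algebraMap] using h1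

/-- The exponent `l < p` with `l + b ≡ m` modulo `p`. -/
def shift (p b m : ℕ) : ℕ := (m + (p - b % p)) % p

theorem shift_lt (hp : 0 < p) (m : ℕ) : shift p b m < p := Nat.mod_lt _ hp

theorem shift_add_mod {m : ℕ} (hm : m < p) : (shift p b m + b) % p = m :=
  add_sub_mod_add_mod (by omega) hm b

theorem shift_ne_zero {m : ℕ} (hm : m < p) (hmb : m ≠ b % p) : shift p b m ≠ 0 :=
  add_sub_mod_ne_zero (by omega) hm hmb

theorem shift_mod_add {l : ℕ} (hl : l < p) : shift p b ((l + b) % p) = l := by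
  have h : (shift p b ((l + b) % p) + b) % p = (l + b) % p :=
    shift_add_mod (Nat.mod_lt _ (by omega))
  have h3 := Nat.ModEq.add_right_cancel' b h
  rwa [Nat.ModEq, Nat.mod_eq_of_lt hl, Nat.mod_eq_of_lt (shift_lt (by omega) _)] at h3

/-- Source of the two exponents in odd degree: reaching a residue below `b % p` crosses one more
multiple of `p`. -/
theorem shift_add_div {m : ℕ} (hm : m < p) :
    (shift p b m + b) / p = if m < b % p then b / p + 1 else b / p := by
  have hp : 0 < p := by omega
  have hb := Nat.mod_lt b hp
  have h1 := Nat.mod_add_div b p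
  by_cases h : m < b % p
  · have h2 : shift p b m = m + (p - b % p) := Nat.mod_eq_of_lt (by omega)
    have h3 : shift p b m + b = m + p * (b / p + 1) := by
      rw [h2, mul_add]
      omega
    rw [if_pos h, h3, Nat.add_mul_div_left _ _ hp, Nat.div_eq_of_lt hm, zero_add]
  · have h2 : shift p b m = m - b % p := by
      rw [shift, show m + (p - b % p) = (m - b % p) + p by omega, Nat.add_mod_right,
        Nat.mod_eq_of_lt (by omega)]
    have h3 : shift p b m + b = m + p * (b / p) := by omega
    rw [if_neg h, h3, Nat.add_mul_div_left _ _ hp, Nat.div_eq_of_lt hm, zero_add]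

theorem repr_beta_smul {β : TwistedGroupRing S T}
    (hβ : ∀ l < p, β • t ^ l = l * stdPow p t s (l + b)) (x : T) (m : Fin p) :
    R.basis.repr (β • x) m = (shift p b m : ℕ) * s ^ ((shift p b m + b) / p) *
      R.basis.repr x ⟨shift p b m, shift_lt R.prime.pos _⟩ := by
  rw [R.smul_eq_sum, map_sum, Finsupp.finsetSum_apply, Finset.sum_eq_single
    ⟨shift p b m, shift_lt R.prime.pos _⟩]
  · rw [hβ _ (shift_lt R.prime.pos _), map_smul, ← map_natCast (algebraMap S T), ← Algebra.smul_def,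
      map_smul, Finsupp.smul_apply, Finsupp.smul_apply, repr_stdPow, if_pos (shift_add_mod m.2),
      smul_eq_mul, smul_eq_mul]
    ring
  · intro l _ hl
    rw [hβ _ l.2, map_smul, ← map_natCast (algebraMap S T), ← Algebra.smul_def,
      map_smul, Finsupp.smul_apply, Finsupp.smul_apply, repr_stdPow, if_neg, smul_zero, smul_zero]
    intro h
    exact hl (Fin.ext ((shift_mod_add l.2).symm.trans (congrArg (shift p b) h)))
  · intro h
    exact absurd (Finset.mem_univ _) h

theorem alpha_smul {α : TwistedGroupRing S T}
    (hα : ∀ l < p, α • t ^ l = if l = b % p then algebraMap S T (s ^ (b - b / p)) else 0) (x : T) :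
    α • x = algebraMap S T (s ^ (b - b / p) *
      R.basis.repr x ⟨b % p, Nat.mod_lt _ R.prime.pos⟩) := by
  rw [R.smul_eq_sum, Finset.sum_eq_single ⟨b % p, Nat.mod_lt _ R.prime.pos⟩]
  · rw [hα _ (Nat.mod_lt _ R.prime.pos), if_pos rfl, Algebra.smul_def, ← map_mul, mul_comm]
  · intro l _ hl
    rw [hα _ l.2, if_neg fun h ↦ hl (Fin.ext h), smul_zero]
  · intro h
    exact absurd (Finset.mem_univ _) h

section

variable [IsDomain S] [IsDomain T] [IsLocalRing T] {α β : TwistedGroupRing S T}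
  (hα : ∀ l < p, α • t ^ l = if l = b % p then algebraMap S T (s ^ (b - b / p)) else 0)
  (hβ : ∀ l < p, β • t ^ l = l * stdPow p t s (l + b))

include R in
omit [IsDomain S] in
theorem pow_ne_zero_bot (n : ℕ) : s ^ n ≠ 0 := fun h ↦
  R.algebraMap_pow_ne_zero n (by rw [h, map_zero])

include R hβ in
theorem beta_smul_eq_zero_iff (x : T) : β • x = 0 ↔ ∃ a, Algebra.linearMap S T a = x := by
  have hp := R.prime.pos
  constructor
  · intro h
    have h0 : ∀ l : Fin p, (l : ℕ) ≠ 0 → R.basis.repr x l = 0 := by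
      intro l hl
      have h1 := R.repr_beta_smul hβ x ⟨(l + b) % p, Nat.mod_lt _ hp⟩
      simp only [shift_mod_add l.2] at h1
      rw [h, map_zero, Finsupp.zero_apply] at h1
      exact (mul_eq_zero.1 h1.symm).resolve_left
        (mul_ne_zero (R.isUnit_natCast _ (not_dvd_of_lt hl l.2)).ne_zero (R.pow_ne_zero_bot _))
    refine ⟨R.basis.repr x ⟨0, hp⟩, ?_⟩
    refine R.basis.repr.injective (Finsupp.ext fun m ↦ ?_)
    rw [Algebra.linearMap_apply, repr_algebraMap]
    split_ifs with hm
    · congr 1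
      exact Fin.ext hm.symm
    · exact (h0 m hm).symm
  · rintro ⟨a, rfl⟩
    rw [Algebra.linearMap_apply, ← mul_one (algebraMap S T a), smul_algebraMap_mul,
      beta_smul_one hβ hp, mul_zero]

include R hα in
omit [IsDomain S] [IsDomain T] [IsLocalRing T] in
theorem exists_alpha_smul_eq_iff (a : S) :
    (∃ y, α • y = algebraMap S T a) ↔ s ^ (b - b / p) ∣ a := by
  constructor
  · rintro ⟨y, hy⟩
    rw [R.alpha_smul hα] at hy
    exact ⟨_, (R.algebraMap_injective hy).symm⟩
  · rintro ⟨c, rfl⟩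
    refine ⟨c • t ^ (b % p), ?_⟩
    rw [Algebra.smul_def, smul_algebraMap_mul, hα _ (Nat.mod_lt _ R.prime.pos), if_pos rfl, ← map_mul,
      mul_comm]

variable (S b) in
/-- The inclusion into `T` of the span of the `t ^ k` with `k < p` and `k ≠ b % p`. -/
noncomputable def powersMap (p : ℕ) (t : T) : ({k : Fin p // (k : ℕ) ≠ b % p} → S) →ₗ[S] T :=
  Fintype.linearCombination S fun k ↦ t ^ ((k : Fin p) : ℕ)

omit [IsDomain S] [IsDomain T] [IsLocalRing T] in
theorem powersMap_apply (a : {k : Fin p // (k : ℕ) ≠ b % p} → S) :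
    powersMap S b p t a = ∑ k, a k • t ^ ((k : Fin p) : ℕ) := rfl

omit [IsDomain S] [IsDomain T] [IsLocalRing T] in
theorem powersMap_single (k : {k : Fin p // (k : ℕ) ≠ b % p}) :
    powersMap S b p t (Pi.single k 1) = t ^ ((k : Fin p) : ℕ) := by
  classical
  exact (Fintype.linearCombination_apply_single _ _ _ _).trans (one_smul _ _)

omit [IsDomain S] [IsDomain T] [IsLocalRing T] in
theorem repr_powersMap (a : {k : Fin p // (k : ℕ) ≠ b % p} → S) (m : Fin p) :
    R.basis.repr (powersMap S b p t a) m = if h : (m : ℕ) ≠ b % p then a ⟨m, h⟩ else 0 := by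
  rw [powersMap_apply, map_sum, Finsupp.finsetSum_apply]
  have h1 : ∀ k : {k : Fin p // (k : ℕ) ≠ b % p},
      R.basis.repr (a k • t ^ ((k : Fin p) : ℕ)) m = if (k : Fin p) = m then a k else 0 := by
    intro k
    rw [← R.basis_apply, map_smul, Finsupp.smul_apply, R.basis.repr_self, Finsupp.single_apply,
      smul_eq_mul, mul_ite, mul_one, mul_zero]
  simp only [h1]
  split_ifs with h
  · rw [Finset.sum_eq_single ⟨m, h⟩]
    · rw [if_pos rfl]
    · intro k _ hk
      exact if_neg fun h2 ↦ hk (Subtype.ext h2)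
    · intro h2
      exact absurd (Finset.mem_univ _) h2
  · exact Finset.sum_eq_zero fun k _ ↦ if_neg fun h2 ↦ h (by rw [← h2]; exact k.2)

include R hα in
theorem alpha_smul_eq_zero_iff (x : T) :
    α • x = 0 ↔ ∃ a, powersMap S b p t a = x := by
  rw [R.alpha_smul hα, map_eq_zero_iff _ R.algebraMap_injective, mul_eq_zero,
    or_iff_right (R.pow_ne_zero_bot _)]
  constructor
  · intro h
    refine ⟨fun k ↦ R.basis.repr x k, R.basis.repr.injective (Finsupp.ext fun m ↦ ?_)⟩
    rw [repr_powersMap]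
    split_ifs with hm
    · rfl
    · rw [← h]
      congr 1
      exact Fin.ext (not_not.1 hm).symm
  · rintro ⟨a, rfl⟩
    rw [repr_powersMap, dif_neg]
    exact fun h ↦ h rfl

include R hβ in
omit [IsDomain S] [IsDomain T] [IsLocalRing T] in
-- Coordinate `k` of `β • y` depends only on coordinate `shift p b k` of `y`. Its integer factor is
-- a unit since `k ≠ b % p`, leaving only the power of `s`.
theorem exists_beta_smul_eq_iff (a : {k : Fin p // (k : ℕ) ≠ b % p} → S) :
    (∃ y, β • y = powersMap S b p t a) ↔
      ∀ k : {k : Fin p // (k : ℕ) ≠ b % p},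
        s ^ (if ((k : Fin p) : ℕ) < b % p then b / p + 1 else b / p) ∣ a k := by
  have hp := R.prime.pos
  constructor
  · rintro ⟨y, hy⟩ k
    have h1 := R.repr_beta_smul hβ y k
    rw [hy, repr_powersMap, dif_pos k.2, shift_add_div k.1.2] at h1
    rw [h1]
    exact (dvd_mul_left _ _).mul_right _
  · intro h
    have h1 : ∀ k : {k : Fin p // (k : ℕ) ≠ b % p}, ∃ y, β • y = a k • t ^ ((k : Fin p) : ℕ) := by
      intro k
      obtain ⟨c, hc⟩ := h k
      obtain ⟨v, hv⟩ := (R.isUnit_natCast _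
        (not_dvd_of_lt (shift_ne_zero k.1.2 k.2) (shift_lt hp _))).exists_right_inv
      refine ⟨(v * c) • t ^ shift p b (k : Fin p), ?_⟩
      rw [Algebra.smul_def, smul_algebraMap_mul, hβ _ (shift_lt hp _), stdPow, shift_add_mod k.1.2,
        shift_add_div k.1.2, hc, Algebra.smul_def, ← map_natCast (algebraMap S T), ← mul_assoc,
        ← mul_assoc, ← map_mul, ← map_mul]
      congr 2
      linear_combination c * s ^ (if ((k : Fin p) : ℕ) < b % p then b / p + 1 else b / p) * hv
    choose y hy using h1
    refine ⟨∑ k, y k, ?_⟩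
    rw [Finset.smul_sum, powersMap_apply]
    exact Finset.sum_congr rfl fun k _ ↦ hy k

end

/-! ### The `Ext` modules -/

section Ext

variable [IsDomain S] [IsDomain T] [IsLocalRing T] {α β : TwistedGroupRing S T}
  (hα : ∀ l < p, α • t ^ l = if l = b % p then algebraMap S T (s ^ (b - b / p)) else 0)
  (hβ : ∀ l < p, β • t ^ l = l * stdPow p t s (l + b)) (P : PeriodicResolution α β)

include R hβ in
omit [IsDomain S] [IsDomain T] [IsLocalRing T] in
theorem isCocycle_even_chi_zero {n : ℕ} (hn : Even n) : P.IsCocycle n (chi S t 0) :=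
  (P.isCocycle_even_iff hn _).2 (by rw [pow_zero, beta_smul_one hβ R.prime.pos])

include R hβ in
theorem exists_linearEquiv_ext_zero (hc : P.IsCocycle 0 (chi S t 0)) :
    ∃ φ : S ≃ₗ[S] Ext (natMod S T) (natMod S T) 0, φ 1 = P.extClass 0 (chi S t 0) hc := by
  obtain ⟨φ, hφ⟩ := P.exists_linearEquiv_ext 0 LinearMap.id Function.surjective_id
    (Algebra.linearMap S T)
    (fun x ↦ (P.isCocycle_even_iff Even.zero x).trans (R.beta_smul_eq_zero_iff hβ x))
    fun a ha ↦ by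
      rw [P.extClass_zero_eq_zero_iff, Algebra.linearMap_apply,
        map_eq_zero_iff _ R.algebraMap_injective, LinearMap.id_apply]
  exact ⟨φ, hφ 1 _ hc (by rw [Algebra.linearMap_apply, map_one, pow_zero])⟩

include R hα hβ in
theorem exists_linearEquiv_ext_even {n : ℕ} (hn : Odd n)
    (hc : P.IsCocycle (n + 1) (chi S t 0)) :
    ∃ φ : (S ⧸ Ideal.span {s ^ (b - b / p)}) ≃ₗ[S] Ext (natMod S T) (natMod S T) (n + 1),
      φ 1 = P.extClass (n + 1) (chi S t 0) hc := by
  obtain ⟨φ, hφ⟩ := P.exists_linearEquiv_ext (n + 1)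
    (Ideal.Quotient.mkₐ S (Ideal.span {s ^ (b - b / p)})).toLinearMap
    Ideal.Quotient.mk_surjective (Algebra.linearMap S T)
    (fun x ↦ (P.isCocycle_even_iff hn.add_one x).trans (R.beta_smul_eq_zero_iff hβ x))
    fun a ha ↦ by
      rw [P.extClass_even_eq_zero_iff hn, Algebra.linearMap_apply, R.exists_alpha_smul_eq_iff hα,
        AlgHom.toLinearMap_apply, Ideal.Quotient.mkₐ_eq_mk, Ideal.Quotient.eq_zero_iff_mem,
        Ideal.mem_span_singleton]
  exact ⟨φ, hφ 1 _ hc (by rw [Algebra.linearMap_apply, map_one, pow_zero])⟩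

include hα in
omit [IsDomain S] [IsDomain T] [IsLocalRing T] in
theorem isCocycle_odd_chi {n : ℕ} (hn : Odd n) {k : ℕ} (hk : k < p) (hkb : k ≠ b % p) :
    P.IsCocycle n (chi S t k) :=
  (P.isCocycle_odd_iff hn _).2 (by rw [hα k hk, if_neg hkb])

include R hα hβ in
theorem exists_linearEquiv_ext_odd {n : ℕ} (hn : Even n)
    (hc : ∀ k : {k : Fin p // (k : ℕ) ≠ b % p}, P.IsCocycle (n + 1) (chi S t (k : Fin p))) :
    ∃ φ : (∀ k : {k : Fin p // (k : ℕ) ≠ b % p},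
        S ⧸ Ideal.span {s ^ (if ((k : Fin p) : ℕ) < b % p then b / p + 1 else b / p)}) ≃ₗ[S]
        Ext (natMod S T) (natMod S T) (n + 1),
      ∀ k, φ (Pi.single k 1) = P.extClass (n + 1) (chi S t (k : Fin p)) (hc k) := by
  let I : {k : Fin p // (k : ℕ) ≠ b % p} → Ideal S := fun k ↦
    Ideal.span {s ^ (if ((k : Fin p) : ℕ) < b % p then b / p + 1 else b / p)}
  let π : ({k : Fin p // (k : ℕ) ≠ b % p} → S) →ₗ[S] (∀ k, S ⧸ I k) :=
    LinearMap.pi fun k ↦ (Ideal.Quotient.mkₐ S (I k)).toLinearMap ∘ₗ LinearMap.proj k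
  have hπ : ∀ a k, π a k = Ideal.Quotient.mk (I k) (a k) := fun _ _ ↦ rfl
  have hsurj : Function.Surjective π := by
    intro c
    choose a ha using fun k ↦ Ideal.Quotient.mk_surjective (c k)
    exact ⟨a, funext ha⟩
  obtain ⟨φ, hφ⟩ := P.exists_linearEquiv_ext (n + 1) π hsurj (powersMap S b p t)
    (fun x ↦ (P.isCocycle_odd_iff hn.add_one x).trans (R.alpha_smul_eq_zero_iff hα x))
    fun a ha ↦ by
      rw [P.extClass_odd_eq_zero_iff hn, R.exists_beta_smul_eq_iff hβ, funext_iff]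
      refine forall_congr' fun k ↦ ?_
      rw [hπ, Pi.zero_apply, Ideal.Quotient.eq_zero_iff_mem, Ideal.mem_span_singleton]
  refine ⟨φ, fun k ↦ ?_⟩
  refine Eq.trans ?_ (hφ (Pi.single k 1) _ (hc k) (powersMap_single k))
  congr 1
  funext j
  rw [hπ]
  by_cases h : j = k
  · subst h
    rw [Pi.single_eq_same, Pi.single_eq_same, map_one]
  · rw [Pi.single_eq_of_ne h, Pi.single_eq_of_ne h, map_zero]

end Ext

end RamificationData

theorem mainTheorem6
    {S : Type u} {T : Type v} {K L : Type*} [CommRing S] [IsDomain S] [IsDiscreteValuationRing S]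
    [CommRing T] [IsDomain T] [IsDiscreteValuationRing T] [Field K] [Field L]
    [Algebra S T] [Algebra S K] [Algebra T L] [Algebra K L] [Algebra S L]
    [IsScalarTower S K L] [IsScalarTower S T L] [IsFractionRing S K] [IsFractionRing T L]
    [Module.Finite S T] [IsGalois K L]
    (p : ℕ) (hp : p.Prime) (hp3 : 3 ≤ p) [CharP (IsLocalRing.ResidueField S) p]
    (hdeg : Module.finrank K L = p)
    (hram : (IsLocalRing.maximalIdeal S).map (algebraMap S T) = IsLocalRing.maximalIdeal T ^ p)
    (σ : T ≃ₐ[S] T) (hσ : Subgroup.zpowers σ = ⊤)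
    (t : T) (ht : Irreducible t)
    (s : S) (hs : s = (-1) ^ (p + 1) * Algebra.norm S t)
    (b : ℕ) (hb : addVal T (σ t - t) = (b : ℕ∞) + 1) (hb1 : 1 ≤ b)
    (hpb : ((b - b / p : ℕ) : ℕ∞) ≤ addVal S (p : S)) :
    ∃ α β : TwistedGroupRing S T,
      (∀ l < p, α • t ^ l = if l = b % p then algebraMap S T (s ^ (b - b / p)) else 0) ∧
      (∀ l < p, β • t ^ l =
        (l : T) * algebraMap S T (s ^ (b / p + (l + b % p) / p)) * t ^ ((l + b % p) % p)) ∧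
      ∃ P : TwistedGroupRing.PeriodicResolution α β,
        (∃ (hc : P.IsCocycle 0 (TwistedGroupRing.chi S t 0))
          (φ : S ≃ₗ[S] Ext (TwistedGroupRing.natMod S T) (TwistedGroupRing.natMod S T) 0),
          φ 1 = P.extClass 0 (TwistedGroupRing.chi S t 0) hc) ∧
        (∀ i : ℕ, 1 ≤ i →
          ∃ (hc : P.IsCocycle (2 * i) (TwistedGroupRing.chi S t 0))
            (φ : (S ⧸ Ideal.span {s ^ (b - b / p)}) ≃ₗ[S]
              Ext (TwistedGroupRing.natMod S T) (TwistedGroupRing.natMod S T) (2 * i)),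
            φ 1 = P.extClass (2 * i) (TwistedGroupRing.chi S t 0) hc) ∧
        (∀ i : ℕ,
          ∃ (hc : ∀ k : {k : Fin p // (k : ℕ) ≠ b % p},
              P.IsCocycle (2 * i + 1) (TwistedGroupRing.chi S t (k : Fin p)))
            (φ : (∀ k : {k : Fin p // (k : ℕ) ≠ b % p},
                S ⧸ Ideal.span {s ^ (if ((k : Fin p) : ℕ) < b % p then b / p + 1 else b / p)}) ≃ₗ[S]
              Ext (TwistedGroupRing.natMod S T) (TwistedGroupRing.natMod S T) (2 * i + 1)),
            ∀ k, φ (Pi.single k 1) =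
              P.extClass (2 * i + 1) (TwistedGroupRing.chi S t (k : Fin p)) (hc k)) := by
  obtain ⟨R⟩ := PurelyRamified.nonempty_ramificationData K L p hp hp3 hdeg hram σ hσ t ht s hs b hb
    hb1
  obtain ⟨α, hα⟩ := R.exists_alpha
  obtain ⟨β, hβ⟩ := R.exists_beta
  refine ⟨α, β, hα, fun l hl ↦ (hβ l hl).trans
    (RamificationData.natCast_mul_stdPow_add hp.pos l b), ?_⟩
  -- Only the fields of `PeriodicResolution` matter from here on, so `P` may be opaque.
  have P := TwistedGroupRing.periodicResolution α β (R.alpha_mul_beta hα hβ)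
    (R.beta_mul_alpha hα hβ) (RamificationData.beta_smul_one hβ hp.pos)
    (fun f hf ↦ R.exists_eq_mul_beta hβ hf)
    (fun f hf ↦ R.exists_eq_mul_alpha hα hβ hf)
    (fun f hf ↦ R.exists_eq_mul_beta hβ (R.smul_one_eq_zero_of_mul_alpha hα hf))
    (fun x ↦ ⟨SkewMonoidAlgebra.single 1 x, by
      rw [TwistedGroupRing.single_smul, map_one, mul_one]⟩)
  refine ⟨P, ⟨R.isCocycle_even_chi_zero hβ P Even.zero, R.exists_linearEquiv_ext_zero hβ P _⟩,
    fun i hi ↦ ?_, fun i ↦ ?_⟩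
  · obtain ⟨n, hn⟩ : ∃ n, 2 * i = n + 1 := ⟨2 * i - 1, by omega⟩
    have hodd : Odd n := ⟨i - 1, by omega⟩
    rw [hn]
    exact ⟨R.isCocycle_even_chi_zero hβ P hodd.add_one,
      R.exists_linearEquiv_ext_even hα hβ P hodd _⟩
  · have heven : Even (2 * i) := even_two_mul i
    exact ⟨fun k ↦ RamificationData.isCocycle_odd_chi hα P heven.add_one k.1.2 k.2,
      R.exists_linearEquiv_ext_odd hα hβ P heven _⟩
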